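/- Write $(q)_N=(1-q)(1-q^2)\cdots(1-q^N)$, let $\mathrm{Li}_s(z)=\sum_{n\ge1}z^n/n^s$ denote the polylogarithm (for $|z|<1$, and also for $|z|\le 1$ when $\Re s>1$); for integers $m\ge 0$, let $\mathrm{Li}_{-m}(z)=\left(z\frac{d}{dz}\right)^m\frac{z}{1-z}$ for all $z\ne1$, which is the continuation of the series. Let $B_n$ be the Bernoulli numbers and $B_n(\lambda)$ the Bernoulli polynomials, $\frac{te^{\lambda t}}{e^t-1}=\sum_{n\ge0}B_n(\lambda)\frac{t^n}{n!}$, $B_n=B_n(0)$. Put $$p(z)=\frac{\mathrm{Li}_2(e^z)-\mathrm{Li}_2(1)}{z},\qquad g_\rho(z)=\left(\frac{-z}{2\pi(1-e^z)}\right)^{1/2}\prod_{j=1}^{k-1}\left(\frac{1-\rho^{-j}e^z}{1-\rho^{-j}}\right)^{j/k-1/2}$$ (principal values of the powers), and for integers $\ell\ge1$, with $\delta_{1,\ell}$ the Kronecker delta, $$f_{\rho,\ell}(z)=\frac{(-1)^{\ell+1}(kz)^\ell}{(\ell+1)!}\left(\frac{\delta_{1,\ell}}{12}+B_{\ell+1}\,\mathrm{Li}_{1-\ell}(e^z)+\sum_{j=1}^{k-1}B_{\ell+1}(j/k)\left\{\mathrm{Li}_{1-\ell}(\rho^{-j}e^z)-\mathrm{Li}_{1-\ell}(\rho^{-j})\right\}\right).$$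 Theorem 4.1. Let $k\ge1$ and $L\ge1$ be integers, and let $\delta>0$ and $C$ be real numbers. Let $\rho$ be a primitive $k$th root of unity, and let $N\ge1$ be an integer with $k\mid N$. Then for all $z\in\mathbb{C}$ with $\Re(z)\le-\delta$ and $|z|\le C$, $$\frac{1}{(\rho e^{z/N})_N}=\left(\frac kN\right)^{1/2}g_\rho(z)\exp\left(\frac Nk\,p(kz)+\sum_{\ell=1}^{L-1}\frac{f_{\rho,\ell}(z)}{N^\ell}+O\left(N^{-L}\right)\right),$$ where the implied constant depends only on $L$, $k$, $\delta$ and $C$. -/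

import Mathlib

/-- The finite product `(q)_N = (1 - q)(1 - q^2) ⋯ (1 - q^N)`. -/
def qProd (q : ℂ) (N : ℕ) : ℂ :=
  ∏ j ∈ Finset.Icc 1 N, (1 - q ^ j)

/-- The polylogarithm series `Li_s(z) = ∑_{n ≥ 1} z^n / n^s`, for `|z| < 1` and any `s`,
or for `|z| ≤ 1` when `Re s > 1`. -/
noncomputable def polylog (s z : ℂ) : ℂ :=
  ∑' n : ℕ, z ^ (n + 1) / ((n : ℂ) + 1) ^ s

/-- The polylogarithm `Li_{-m}` of nonpositive integer order `-m` as a function on `ℂ ∖ {1}`: the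
rational function `(z d/dz)^m (z / (1 - z))`, which continues the series `polylog (-m)` from
the unit disc (see `polylogNonpos_eq_polylog`). In particular it gives the values of `Li_{-m}` at
the points `z ≠ 1` of the unit circle, where the series diverges. -/
noncomputable def polylogNonpos (m : ℕ) : ℂ → ℂ :=
  (fun (f : ℂ → ℂ) (z : ℂ) => z * deriv f z)^[m] (fun z => z / (1 - z))

/-- On the unit disc, `polylogNonpos m` is the sum of the polylogarithm series of order `-m`. -/
theorem polylogNonpos_eq_polylog (m : ℕ) (z : ℂ) (hz : ‖z‖ < 1) :
    polylogNonpos m z = polylog (-(m : ℂ)) z := by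
  have key : ∀ m : ℕ, ∀ z : ℂ, ‖z‖ < 1 →
      polylogNonpos m z = ∑' n : ℕ, ((n : ℂ) + 1) ^ m * z ^ (n + 1) := by
    intro m
    induction m with
    | zero =>
      intro z hz
      simp only [polylogNonpos, Function.iterate_zero, id, pow_zero, one_mul, pow_succ]
      rw [tsum_mul_right, tsum_geometric_of_norm_lt_one hz, div_eq_mul_inv, mul_comm]
    | succ m ih =>
      intro z hz
      have hstep : polylogNonpos (m + 1) z = z * deriv (polylogNonpos m) z := by
        simp only [polylogNonpos, Function.iterate_succ_apply']
      have hev : polylogNonpos m =ᶠ[nhds z]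
          fun w => ∑' n : ℕ, ((n : ℂ) + 1) ^ m * w ^ (n + 1) := by
        filter_upwards [(isOpen_lt continuous_norm continuous_const).mem_nhds hz] with w hw
        exact ih w hw
      obtain ⟨r, hr, hr1⟩ := exists_between hz
      have hr0 : 0 ≤ r := (norm_nonneg z).trans hr.le
      have hsum : Summable fun n : ℕ => ((n : ℝ) + 1) ^ (m + 1) * r ^ n := by
        have h1 : Summable fun n : ℕ => ((n : ℝ)) ^ (m + 1) * r ^ n :=
          summable_pow_mul_geometric_of_norm_lt_one (m + 1)
            (by rwa [Real.norm_eq_abs, abs_of_nonneg hr0])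
        have h0 : Summable fun n : ℕ => r ^ n := summable_geometric_of_lt_one hr0 hr1
        refine Summable.of_nonneg_of_le (fun n => by positivity) (fun n => ?_)
          ((h1.add h0).mul_left (2 ^ (m + 1)))
        have h2 : ((n : ℝ) + 1) ^ (m + 1) ≤ 2 ^ (m + 1) * ((n : ℝ) ^ (m + 1) + 1) := by
          rcases Nat.eq_zero_or_pos n with h | h
          · subst h
            have : (1 : ℝ) ≤ 2 ^ (m + 1) := one_le_pow₀ (by norm_num)
            simpa using this
          · have hn : (1 : ℝ) ≤ n := by exact_mod_cast h
            calc ((n : ℝ) + 1) ^ (m + 1) ≤ (2 * n) ^ (m + 1) := by gcongr; linarith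
              _ = 2 ^ (m + 1) * (n : ℝ) ^ (m + 1) := mul_pow _ _ _
              _ ≤ _ := by gcongr; linarith
        calc ((n : ℝ) + 1) ^ (m + 1) * r ^ n
            ≤ (2 ^ (m + 1) * ((n : ℝ) ^ (m + 1) + 1)) * r ^ n := by gcongr
          _ = _ := by ring
      have hd : HasDerivAt (fun w : ℂ => ∑' n : ℕ, ((n : ℂ) + 1) ^ m * w ^ (n + 1))
          (∑' n : ℕ, ((n : ℂ) + 1) ^ (m + 1) * z ^ n) z := by
        refine hasDerivAt_tsum_of_isPreconnected (𝕜 := ℂ)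
          (u := fun n : ℕ => ((n : ℝ) + 1) ^ (m + 1) * r ^ n) hsum
          (t := Metric.ball (0 : ℂ) r) Metric.isOpen_ball
          (convex_ball (0 : ℂ) r).isPreconnected
          (g := fun n w => ((n : ℂ) + 1) ^ m * w ^ (n + 1))
          (g' := fun n w => ((n : ℂ) + 1) ^ (m + 1) * w ^ n) (fun n w _ => ?_) (fun n w hw => ?_)
          (y₀ := 0) (Metric.mem_ball_self ((norm_nonneg z).trans_lt hr)) ?_ (by simpa using hr)
        · have := (hasDerivAt_pow (n + 1) w).const_mul (((n : ℂ) + 1) ^ m)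
          refine this.congr_deriv ?_
          push_cast
          ring
        · have hw' : ‖w‖ ≤ r := by simpa using (Metric.mem_ball.1 hw).le
          have h3 : ‖(n : ℂ) + 1‖ = (n : ℝ) + 1 := by
            have := Complex.norm_natCast (n + 1)
            push_cast at this
            exact this
          rw [norm_mul, norm_pow, norm_pow, h3]
          gcongr
        · simp [summable_zero]
      rw [hstep, hev.deriv_eq, hd.deriv, ← tsum_mul_left]
      refine tsum_congr fun n => ?_
      ring
  rw [key m z hz, polylog]
  refine tsum_congr fun n => ?_
  rw [Complex.cpow_neg, Complex.cpow_natCast, div_inv_eq_mul, mul_comm]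

/-- `p(z) = (Li_2(e^z) - Li_2(1)) / z`. -/
noncomputable def pFun (z : ℂ) : ℂ :=
  (polylog 2 (Complex.exp z) - polylog 2 1) / z

/-- `g_ρ(z) = (-z / (2π(1 - e^z)))^{1/2} ∏_{j=1}^{k-1} ((1 - ρ^{-j} e^z) / (1 - ρ^{-j}))^{j/k - 1/2}`,
with principal values of the powers. -/
noncomputable def gFun (k : ℕ) (ρ z : ℂ) : ℂ :=
  (-z / (2 * (Real.pi : ℂ) * (1 - Complex.exp z))) ^ (1 / 2 : ℂ) *
    ∏ j ∈ Finset.Ico 1 k,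
      ((1 - (ρ ^ j)⁻¹ * Complex.exp z) / (1 - (ρ ^ j)⁻¹)) ^ ((j : ℂ) / (k : ℂ) - 1 / 2)

/-- The coefficient `f_{ρ,ℓ}(z)`, for `ℓ ≥ 1`; here `B_n = bernoulli n`, the value `B_n(λ)` of the
Bernoulli polynomial is `(Polynomial.bernoulli n).eval λ`, and `Li_{1-ℓ} = polylogNonpos (ℓ - 1)`. -/
noncomputable def fFun (k : ℕ) (ρ : ℂ) (ℓ : ℕ) (z : ℂ) : ℂ :=
  (-1) ^ (ℓ + 1) * ((k : ℂ) * z) ^ ℓ / (Nat.factorial (ℓ + 1) : ℂ) *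
    ((if ℓ = 1 then (1 / 12 : ℂ) else 0) +
      ((bernoulli (ℓ + 1) : ℚ) : ℂ) * polylogNonpos (ℓ - 1) (Complex.exp z) +
      ∑ j ∈ Finset.Ico 1 k,
        (((Polynomial.bernoulli (ℓ + 1)).eval ((j : ℚ) / (k : ℚ)) : ℚ) : ℂ) *
          (polylogNonpos (ℓ - 1) ((ρ ^ j)⁻¹ * Complex.exp z) -
            polylogNonpos (ℓ - 1) ((ρ ^ j)⁻¹)))

open Filter Topology MeasureTheory Set

/-! Write `N = k n` and split the product by residues: with exponent `k (i + 1) - j`, where `0 ≤ j <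
k` and `0 ≤ i < n`, the factor is `1 - ζ exp ((z / n) (i + t))` with `ζ = ρ^(-j)` and `t = 1 - j /
k`. The logarithm of each residue class is a sum over shifted integers, so Euler-Maclaurin with
offset `t` expands it in Bernoulli polynomials at `t`.

For `j ≠ 0` the function `log (1 - ζ e^w)` is holomorphic near every point `z x / n`, `0 ≤ x ≤ n`
(`exists_sum_log_one_sub_bound`). For `j = 0` it is singular at `w = 0`, so it is split as `log (-w)
+ log ((e^w - 1) / w)`. The second part is regular at 0; the first sums exactly to `n log (-z / n) +
log n!`, and Stirling's series cancels its divergent terms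
(`exists_sum_logExpQuot_add_log_factorial_bound`).

The integrals are dilogarithms, which the distribution relation merges into `(N / k) p (k z)`. The
`B_1` terms, with the constants from Stirling, give `(k / N)^(1/2) g_ρ`. The higher terms give
`f_{ρ,ℓ}`, whose `1 / 12` is the contribution of `log ((e^w - 1) / w)` at the origin.

Uniformity in `z` comes from compactness of a truncated sector that contains all admissible `z` and
is star-shaped about 0. Uniformity in `ρ` holds because there are only finitely many `k`th roots of
unity. -/

/-! ### Bernoulli polynomials and Euler-Maclaurin summation with an offset -/

/-- The function `B_m(x) / m!`. -/
noncomputable def bernoulliNormalized (m : ℕ) (x : ℝ) : ℂ :=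
  ((Polynomial.bernoulli m).map (algebraMap ℚ ℂ)).eval (x : ℂ) / (Nat.factorial m : ℂ)

theorem bernoulliNormalized_ratCast (m : ℕ) (x : ℚ) :
    bernoulliNormalized m (x : ℝ) =
      (((Polynomial.bernoulli m).eval x : ℚ) : ℂ) / (Nat.factorial m : ℂ) := by
  have h : (((x : ℚ) : ℝ) : ℂ) = algebraMap ℚ ℂ x := by simp
  rw [bernoulliNormalized, h, Polynomial.eval_map_apply]
  simp

theorem bernoulliNormalized_zero (x : ℝ) : bernoulliNormalized 0 x = 1 := by
  simp [bernoulliNormalized]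

theorem bernoulliNormalized_one (x : ℝ) : bernoulliNormalized 1 x = x - 1 / 2 := by
  simp [bernoulliNormalized, Polynomial.bernoulli_one]

theorem bernoulliNormalized_apply_one {m : ℕ} (hm : m ≠ 1) :
    bernoulliNormalized m 1 = bernoulliNormalized m 0 := by
  have h1 := bernoulliNormalized_ratCast m 1
  have h0 := bernoulliNormalized_ratCast m 0
  rw [Rat.cast_one] at h1
  rw [Rat.cast_zero] at h0
  rw [h1, h0, Polynomial.bernoulli_eval_one, Polynomial.bernoulli_eval_zero,
    bernoulli_eq_bernoulli'_of_ne_one hm]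

theorem hasDerivAt_bernoulliNormalized (m : ℕ) (x : ℝ) :
    HasDerivAt (bernoulliNormalized (m + 1)) (bernoulliNormalized m x) x := by
  have h := (((Polynomial.bernoulli (m + 1)).map (algebraMap ℚ ℂ)).hasDerivAt
    (x : ℂ)).comp_ofReal.div_const (Nat.factorial (m + 1) : ℂ)
  refine h.congr_deriv ?_
  rw [Polynomial.derivative_map, Polynomial.derivative_bernoulli_add_one, bernoulliNormalized,
    Nat.factorial_succ]
  have h1 : ((m : ℂ) + 1) ≠ 0 := by exact_mod_cast m.succ_ne_zero
  have h2 : (Nat.factorial m : ℂ) ≠ 0 := by exact_mod_cast m.factorial_ne_zero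
  simp only [Polynomial.map_mul, Polynomial.map_add, Polynomial.map_natCast, Polynomial.map_one,
    Polynomial.eval_mul, Polynomial.eval_add, Polynomial.eval_natCast, Polynomial.eval_one]
  push_cast
  field_simp

theorem continuous_bernoulliNormalized (m : ℕ) : Continuous (bernoulliNormalized m) := by
  unfold bernoulliNormalized
  fun_prop

/-- The Peano kernel remainder of the Euler-Maclaurin formula on `[a, a + 1]` with offset `t`. -/
noncomputable def eulerMaclaurinRemainder (f : ℕ → ℝ → ℂ) (a t : ℝ) (M : ℕ) : ℂ :=
  (∫ x in a..(a + t), bernoulliNormalized M (a + t - x) * f M x) +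
    ∫ x in (a + t)..(a + 1), bernoulliNormalized M (a + 1 + t - x) * f M x

theorem integral_bernoulliNormalized_succ_mul {f : ℕ → ℝ → ℂ} {α β : ℝ} (hαβ : α ≤ β) (c : ℝ)
    (hf : ∀ m, ∀ x ∈ Icc α β, HasDerivAt (f m) (f (m + 1) x) x) (M : ℕ) :
    ∫ x in α..β, bernoulliNormalized (M + 1) (c - x) * f (M + 1) x =
      bernoulliNormalized (M + 1) (c - β) * f M β - bernoulliNormalized (M + 1) (c - α) * f M α +
        ∫ x in α..β, bernoulliNormalized M (c - x) * f M x := by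
  have hcont : ∀ m, ContinuousOn (f m) (uIcc α β) := fun m x hx =>
    (hf m x (by rwa [uIcc_of_le hαβ] at hx)).continuousAt.continuousWithinAt
  have hb : Continuous fun x : ℝ => bernoulliNormalized M (c - x) :=
    (continuous_bernoulliNormalized M).comp (continuous_const.sub continuous_id)
  have h := intervalIntegral.integral_mul_deriv_eq_deriv_mul (a := α) (b := β)
    (u := fun x => bernoulliNormalized (M + 1) (c - x)) (v := f M)
    (u' := fun x => -bernoulliNormalized M (c - x)) (v' := f (M + 1)) ?_ ?_ ?_ ?_
  · rw [h]
    simp only [neg_mul, intervalIntegral.integral_neg, sub_neg_eq_add]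
  · intro x _
    have := (hasDerivAt_bernoulliNormalized M (c - x)).scomp x ((hasDerivAt_id x).const_sub c)
    simpa [Function.comp_def] using this
  · intro x hx
    exact hf M x (by rwa [uIcc_of_le hαβ] at hx)
  · exact hb.neg.intervalIntegrable _ _
  · exact (hcont _).intervalIntegrable

/-- The kernel is the periodized Bernoulli polynomial, cut at its possible jump `x = a + t`.
Integrating by parts on both sides, the boundary terms at the cut cancel because `B_m(0) = B_m(1)`,
except for `m = 1`, where the jump produces the value `f 0 (a + t)`. -/
theorem euler_maclaurin_unit_interval {f : ℕ → ℝ → ℂ} {a t : ℝ} (ht0 : 0 ≤ t) (ht1 : t ≤ 1)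
    (hf : ∀ m, ∀ x ∈ Icc a (a + 1), HasDerivAt (f m) (f (m + 1) x) x) (M : ℕ) :
    f 0 (a + t) = (∫ x in a..(a + 1), f 0 x) +
      ∑ m ∈ Finset.range (M + 1), bernoulliNormalized (m + 1) t * (f m (a + 1) - f m a) -
        eulerMaclaurinRemainder f a t (M + 1) := by
  have step : ∀ M, eulerMaclaurinRemainder f a t (M + 1) =
      bernoulliNormalized (M + 1) t * (f M (a + 1) - f M a) +
        (bernoulliNormalized (M + 1) 0 - bernoulliNormalized (M + 1) 1) * f M (a + t) +
          eulerMaclaurinRemainder f a t M := by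
    intro M
    rw [eulerMaclaurinRemainder, eulerMaclaurinRemainder,
      integral_bernoulliNormalized_succ_mul (by linarith) (a + t)
        (fun m x hx => hf m x ⟨hx.1, by linarith [hx.2]⟩) M,
      integral_bernoulliNormalized_succ_mul (by linarith) (a + 1 + t)
        (fun m x hx => hf m x ⟨by linarith [hx.1], hx.2⟩) M]
    have e1 : a + t - (a + t) = 0 := by ring
    have e2 : a + t - a = t := by ring
    have e3 : a + 1 + t - (a + 1) = t := by ring
    have e4 : a + 1 + t - (a + t) = 1 := by ring
    rw [e1, e2, e3, e4]
    ring
  have hcont : ContinuousOn (f 0) (Icc a (a + 1)) := fun x hx =>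
    (hf 0 x hx).continuousAt.continuousWithinAt
  have zero : eulerMaclaurinRemainder f a t 0 = ∫ x in a..(a + 1), f 0 x := by
    simp only [eulerMaclaurinRemainder, bernoulliNormalized_zero, one_mul]
    refine intervalIntegral.integral_add_adjacent_intervals
      (ContinuousOn.intervalIntegrable (hcont.mono ?_))
      (ContinuousOn.intervalIntegrable (hcont.mono ?_))
    · rw [uIcc_of_le (by linarith)]
      exact Icc_subset_Icc le_rfl (by linarith)
    · rw [uIcc_of_le (by linarith)]
      exact Icc_subset_Icc (by linarith) le_rfl
  induction M with
  | zero =>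
    rw [step 0, zero]
    simp only [zero_add, Finset.sum_range_one, bernoulliNormalized_one]
    push_cast
    ring
  | succ M ih =>
    rw [Finset.sum_range_succ, step (M + 1), bernoulliNormalized_apply_one (by omega)]
    rw [ih]
    ring

theorem exists_norm_bernoulliNormalized_le (m : ℕ) :
    ∃ c : ℝ, 0 ≤ c ∧ ∀ x ∈ Icc (0 : ℝ) 1, ‖bernoulliNormalized m x‖ ≤ c := by
  obtain ⟨c, hc⟩ := isCompact_Icc.exists_bound_of_continuousOn
    (continuous_bernoulliNormalized m).continuousOn (s := Icc (0 : ℝ) 1)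
  exact ⟨c, (norm_nonneg _).trans (hc 0 (by simp)), hc⟩

theorem norm_sum_unit_interval_sub_le (M : ℕ) :
    ∃ c : ℝ, 0 ≤ c ∧ ∀ (f : ℕ → ℝ → ℂ) (a t B : ℝ), 0 ≤ t → t ≤ 1 →
      (∀ m, ∀ x ∈ Icc a (a + 1), HasDerivAt (f m) (f (m + 1) x) x) →
      (∀ x ∈ Icc a (a + 1), ‖f (M + 1) x‖ ≤ B) →
        ‖f 0 (a + t) - ((∫ x in a..(a + 1), f 0 x) +
          ∑ m ∈ Finset.range M, bernoulliNormalized (m + 1) t * (f m (a + 1) - f m a))‖ ≤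
            c * B := by
  obtain ⟨c, hc0, hc⟩ := exists_norm_bernoulliNormalized_le (M + 1)
  -- The expansion is taken one order further than needed. The extra boundary term costs one `c *
  -- B`, by the mean value inequality, and each half of the remainder costs another.
  refine ⟨3 * c, by positivity, fun f a t B ht0 ht1 hf hB => ?_⟩
  have hB0 : 0 ≤ B := (norm_nonneg _).trans (hB a ⟨le_rfl, by linarith⟩)
  have hmv : ‖f M (a + 1) - f M a‖ ≤ B := by
    have := (convex_Icc a (a + 1)).norm_image_sub_le_of_norm_hasDerivWithin_le
      (f := f M) (f' := f (M + 1)) (C := B) (x := a) (y := a + 1)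
      (fun x hx => (hf M x hx).hasDerivWithinAt) hB ⟨le_rfl, by linarith⟩ ⟨by linarith, le_rfl⟩
    simpa using this
  have hR : ‖eulerMaclaurinRemainder f a t (M + 1)‖ ≤ c * B + c * B := by
    refine (norm_add_le _ _).trans (add_le_add ?_ ?_)
    · refine (intervalIntegral.norm_integral_le_of_norm_le_const (C := c * B) ?_).trans ?_
      · intro x hx
        rw [uIoc_of_le (by linarith)] at hx
        rw [norm_mul]
        exact mul_le_mul (hc _ ⟨by linarith [hx.2], by linarith [hx.1]⟩)
          (hB _ ⟨hx.1.le, by linarith [hx.2]⟩) (norm_nonneg _) hc0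
      · rw [abs_of_nonneg (by linarith)]
        exact mul_le_of_le_one_right (by positivity) (by linarith)
    · refine (intervalIntegral.norm_integral_le_of_norm_le_const (C := c * B) ?_).trans ?_
      · intro x hx
        rw [uIoc_of_le (by linarith)] at hx
        rw [norm_mul]
        exact mul_le_mul (hc _ ⟨by linarith [hx.2], by linarith [hx.1]⟩)
          (hB _ ⟨by linarith [hx.1], hx.2⟩) (norm_nonneg _) hc0
      · rw [abs_of_nonneg (by linarith)]
        exact mul_le_of_le_one_right (by positivity) (by linarith)
  rw [euler_maclaurin_unit_interval ht0 ht1 hf M, Finset.sum_range_succ]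
  have e : ∀ I S X R : ℂ, I + (S + X) - R - (I + S) = X - R := fun _ _ _ _ => by ring
  rw [e]
  refine (norm_sub_le _ _).trans ?_
  rw [norm_mul]
  have : ‖bernoulliNormalized (M + 1) t‖ * ‖f M (a + 1) - f M a‖ ≤ c * B :=
    mul_le_mul (hc _ ⟨ht0, ht1⟩) hmv (norm_nonneg _) hc0
  linarith

theorem norm_sum_sub_euler_maclaurin_le (M : ℕ) :
    ∃ c : ℝ, 0 ≤ c ∧ ∀ (f : ℕ → ℝ → ℂ) (n : ℕ) (t B : ℝ), 0 ≤ t → t ≤ 1 →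
      (∀ m, ∀ x ∈ Icc (0 : ℝ) n, HasDerivAt (f m) (f (m + 1) x) x) →
      (∀ x ∈ Icc (0 : ℝ) n, ‖f (M + 1) x‖ ≤ B) →
        ‖∑ i ∈ Finset.range n, f 0 (i + t) - ((∫ x in (0 : ℝ)..n, f 0 x) +
          ∑ m ∈ Finset.range M, bernoulliNormalized (m + 1) t * (f m n - f m 0))‖ ≤
            c * B * n := by
  obtain ⟨c, hc0, hc⟩ := norm_sum_unit_interval_sub_le M
  refine ⟨c, hc0, fun f n t B ht0 ht1 hf hB => ?_⟩
  have hsub : ∀ i ∈ Finset.range n, Icc (i : ℝ) (i + 1) ⊆ Icc (0 : ℝ) n := by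
    intro i hi
    have : (i : ℝ) + 1 ≤ n := by exact_mod_cast Finset.mem_range.1 hi
    exact Icc_subset_Icc (Nat.cast_nonneg i) this
  have hint : ∑ i ∈ Finset.range n, ∫ x in (i : ℝ)..(i + 1), f 0 x = ∫ x in (0 : ℝ)..n, f 0 x := by
    have := intervalIntegral.sum_integral_adjacent_intervals (f := f 0) (μ := volume)
      (a := fun i : ℕ => (i : ℝ)) (n := n) ?_
    · simpa using this
    · intro i hi
      refine ContinuousOn.intervalIntegrable fun x hx =>
        (hf 0 x (hsub i (Finset.mem_range.2 hi) ?_)).continuousAt.continuousWithinAt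
      rw [uIcc_of_le (by simp)] at hx
      simpa using hx
  have htel : ∀ m, ∑ i ∈ Finset.range n, (f m (i + 1) - f m i) = f m n - f m 0 := by
    intro m
    have := Finset.sum_range_sub (fun i : ℕ => f m i) n
    simpa using this
  have hsum : ∑ i ∈ Finset.range n, f 0 (i + t) - ((∫ x in (0 : ℝ)..n, f 0 x) +
      ∑ m ∈ Finset.range M, bernoulliNormalized (m + 1) t * (f m n - f m 0)) =
      ∑ i ∈ Finset.range n, (f 0 (i + t) - ((∫ x in (i : ℝ)..(i + 1), f 0 x) +
        ∑ m ∈ Finset.range M, bernoulliNormalized (m + 1) t * (f m (i + 1) - f m i))) := by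
    rw [Finset.sum_sub_distrib, Finset.sum_add_distrib, hint, Finset.sum_comm]
    simp only [← Finset.mul_sum, htel]
  rw [hsum]
  refine (norm_sum_le_of_le (Finset.range n) fun (i : ℕ) hi => hc f i t B ht0 ht1
    (fun m x hx => hf m x (hsub i hi hx)) (fun x hx => hB x (hsub i hi hx))).trans ?_
  simp [mul_comm]

/-! ### Stirling's series to arbitrary order -/

/-- The iterated derivatives of the real logarithm, as complex-valued functions. -/
noncomputable def logDerivs : ℕ → ℝ → ℂ
  | 0, x => (Real.log x : ℂ)
  | m + 1, x => (-1) ^ m * (Nat.factorial m : ℂ) / (x : ℂ) ^ (m + 1)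

theorem hasDerivAt_logDerivs (m : ℕ) {x : ℝ} (hx : 0 < x) :
    HasDerivAt (logDerivs m) (logDerivs (m + 1) x) x := by
  have hx' : (x : ℂ) ≠ 0 := by exact_mod_cast hx.ne'
  cases m with
  | zero =>
    refine (Real.hasDerivAt_log hx.ne').ofReal_comp.congr_deriv ?_
    simp [logDerivs]
  | succ m =>
    have h1 : HasDerivAt (fun y : ℝ => (y : ℂ)) 1 x := (hasDerivAt_id x).ofReal_comp
    have h := ((h1.fun_pow (m + 1)).fun_inv (pow_ne_zero _ hx')).const_mul
      ((-1) ^ m * (Nat.factorial m : ℂ))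
    refine (h.congr_deriv ?_).congr_of_eventuallyEq (Eventually.of_forall fun y => ?_)
    · simp only [logDerivs, Nat.factorial_succ]
      push_cast
      field_simp
      ring
    · simp [logDerivs, div_eq_mul_inv]

theorem norm_sub_le_of_tendsto_of_telescoping {a : ℕ → ℂ} {l : ℂ} {u : ℕ → ℝ}
    (ha : Tendsto a atTop (𝓝 l)) (hu : Tendsto u atTop (𝓝 0))
    (h : ∀ i, 1 ≤ i → ‖a (i + 1) - a i‖ ≤ u i - u (i + 1)) {n : ℕ} (hn : 1 ≤ n) :
    ‖a n - l‖ ≤ u n := by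
  have key : ∀ m, n ≤ m → ‖a m - a n‖ ≤ u n - u m := by
    intro m hm
    induction m, hm using Nat.le_induction with
    | base => simp
    | succ m hm ih =>
      have := norm_add_le (a (m + 1) - a m) (a m - a n)
      rw [sub_add_sub_cancel] at this
      linarith [h m (hn.trans hm)]
  have h1 : Tendsto (fun m => ‖a m - a n‖) atTop (𝓝 ‖l - a n‖) := (ha.sub_const _).norm
  have h2 : Tendsto (fun m => u n - u m) atTop (𝓝 (u n - 0)) := hu.const_sub _
  rw [norm_sub_rev]
  simpa using le_of_tendsto_of_tendsto h1 h2 (eventually_atTop.2 ⟨n, key⟩)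

/-- The difference on the right is at least `1 / (x^L (x + 1))`, and `x + 1 ≤ 2 x`. This turns a
step error of order `L + 1` into a telescoping one of order `L`. -/
theorem inv_pow_succ_le_sub {L : ℕ} (hL : 1 ≤ L) {x : ℝ} (hx : 1 ≤ x) :
    1 / x ^ (L + 1) ≤ 2 * (1 / x ^ L - 1 / (x + 1) ^ L) := by
  have hx0 : 0 < x := by linarith
  obtain ⟨m, rfl⟩ : ∃ m, L = m + 1 := ⟨L - 1, by omega⟩
  have h1 : x ^ m ≤ (x + 1) ^ m := pow_le_pow_left₀ hx0.le (by linarith) m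
  have h2 : 1 / (x + 1) ^ (m + 1) ≤ 1 / (x ^ m * (x + 1)) := by
    rw [pow_succ]
    gcongr
  have h3 : 1 / x ^ (m + 1) - 1 / (x ^ m * (x + 1)) = 1 / (x ^ (m + 1) * (x + 1)) := by
    field_simp
    ring
  have h4 : 1 / x ^ (m + 1 + 1) ≤ 2 * (1 / (x ^ (m + 1) * (x + 1))) := by
    rw [pow_succ x (m + 1), mul_one_div, div_le_div_iff₀ (by positivity) (by positivity)]
    have : 0 < x ^ (m + 1) := by positivity
    nlinarith
  linarith

/-- Subtract from `log n!` all non-constant terms of the expansion. Consecutive differences of the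
resulting sequence are Euler-Maclaurin errors for `log` on `[n, n + 1]` with offset 1, hence
`O(n^(-L-1))`. The limit is known from Stirling's formula, so summing the tail gives `O(n^(-L))`. -/
theorem stirling_series {L : ℕ} (hL : 1 ≤ L) :
    ∃ c : ℝ, 0 ≤ c ∧ ∀ n : ℕ, 1 ≤ n →
      ‖(Real.log (Nat.factorial n) : ℂ) - (n * Real.log n - n + 1 / 2 * Real.log (2 * Real.pi) +
        ∑ m ∈ Finset.range L, bernoulliNormalized (m + 1) 1 * logDerivs m n)‖ ≤ c / n ^ L := by
  obtain ⟨c, hc0, hc⟩ := norm_sum_unit_interval_sub_le L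
  set F : ℝ := (Nat.factorial L : ℝ) with hF
  have hF0 : 0 ≤ F := by positivity
  set a : ℕ → ℂ := fun n => (Real.log (Nat.factorial n) : ℂ) - (n * Real.log n - n) -
    ∑ m ∈ Finset.range L, bernoulliNormalized (m + 1) 1 * logDerivs m n with ha
  set u : ℕ → ℝ := fun n => 2 * (c * F) * (1 / (n : ℝ) ^ L) with hu
  have hu0 : Tendsto u atTop (𝓝 0) := by
    have := (tendsto_pow_neg_atTop (𝕜 := ℝ) (n := L) (by omega)).comp tendsto_natCast_atTop_atTop
    simpa [hu, Function.comp_def] using this.const_mul (2 * (c * F))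
  have ha0 : Tendsto a atTop (𝓝 (1 / 2 * Real.log (2 * Real.pi) : ℂ)) := by
    -- `Stirling.stirlingSeq` is normalized by `√(2 n)`, while the term `m = 0` here removes only
    -- `(1 / 2) log n`; the summand `(1 / 2) log 2` makes up the difference.
    have h1 : Tendsto (fun n : ℕ => ((Real.log (Stirling.stirlingSeq n) + 1 / 2 * Real.log 2 : ℝ) : ℂ)) atTop
        (𝓝 (((Real.log (√Real.pi) + 1 / 2 * Real.log 2 : ℝ) : ℂ))) :=
      (Complex.continuous_ofReal.tendsto _).comp
        ((Stirling.tendsto_stirlingSeq_sqrt_pi.log (by positivity)).add_const _)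
    have h2 : Tendsto (fun n : ℕ => ∑ m ∈ Finset.Ico 1 L, bernoulliNormalized (m + 1) 1 *
        logDerivs m n) atTop (𝓝 (∑ m ∈ Finset.Ico 1 L, bernoulliNormalized (m + 1) 1 * 0)) := by
      refine tendsto_finsetSum _ fun m hm => Tendsto.const_mul _ ?_
      obtain ⟨p, rfl⟩ : ∃ p, m = p + 1 := ⟨m - 1, by have := (Finset.mem_Ico.1 hm).1; omega⟩
      have := (tendsto_pow_neg_atTop (𝕜 := ℝ) (n := p + 1) (by omega)).comp
        tendsto_natCast_atTop_atTop
      have := ((Complex.continuous_ofReal.tendsto _).comp this).const_mul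
        ((-1) ^ p * (Nat.factorial p : ℂ))
      simpa only [logDerivs, Function.comp_def, div_eq_mul_inv, zpow_neg, zpow_natCast, Complex.ofReal_inv,
        Complex.ofReal_pow, Complex.ofReal_natCast, Complex.ofReal_zero, mul_zero] using this
    have h3 := h1.sub h2
    have e : ((Real.log (√Real.pi) + 1 / 2 * Real.log 2 : ℝ) : ℂ) -
        ∑ m ∈ Finset.Ico 1 L, bernoulliNormalized (m + 1) 1 * 0 =
        (1 / 2 * Real.log (2 * Real.pi) : ℂ) := by
      rw [Real.log_sqrt Real.pi_pos.le, Real.log_mul (by norm_num) Real.pi_pos.ne']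
      simp
      ring
    rw [e] at h3
    refine h3.congr' (eventually_atTop.2 ⟨1, fun n hn => ?_⟩)
    have hn0 : (n : ℝ) ≠ 0 := by positivity
    rw [Stirling.log_stirlingSeq_formula, Real.log_mul (by norm_num) hn0,
      Real.log_div hn0 (Real.exp_pos 1).ne', Real.log_exp]
    simp only [ha]
    rw [Finset.range_eq_Ico, Finset.sum_eq_sum_Ico_succ_bot (Nat.lt_of_lt_of_le zero_lt_one hL),
      bernoulliNormalized_one]
    simp only [logDerivs]
    push_cast
    ring
  have hstep : ∀ i, 1 ≤ i → ‖a (i + 1) - a i‖ ≤ u i - u (i + 1) := by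
    intro i hi
    have hi1 : (1 : ℝ) ≤ i := by exact_mod_cast hi
    have hi0 : (0 : ℝ) < i := by linarith
    have h := hc logDerivs i 1 (F * (1 / (i : ℝ) ^ (L + 1))) zero_le_one le_rfl
      (fun m x hx => hasDerivAt_logDerivs m (hi0.trans_le hx.1)) (fun x hx => by
        have hx0 : 0 < x := hi0.trans_le hx.1
        simp only [logDerivs, norm_div, norm_mul, norm_pow, norm_neg, norm_one, one_pow, one_mul,
          Complex.norm_natCast, Complex.norm_real, Real.norm_eq_abs, abs_of_pos hx0]
        rw [mul_one_div]
        have := hx.1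
        gcongr)
    have e : a (i + 1) - a i = logDerivs 0 (i + 1) - ((∫ x in (i : ℝ)..(i + 1), logDerivs 0 x) +
        ∑ m ∈ Finset.range L, bernoulliNormalized (m + 1) 1 *
          (logDerivs m (i + 1) - logDerivs m i)) := by
      have hI : (∫ x in (i : ℝ)..(i + 1), logDerivs 0 x) =
          (((i + 1) * Real.log (i + 1) - i * Real.log i - (i + 1) + i : ℝ) : ℂ) := by
        simp only [logDerivs]
        rw [intervalIntegral.integral_ofReal, integral_log]
      have hfac : Real.log (Nat.factorial (i + 1)) =
          Real.log (i + 1) + Real.log (Nat.factorial i) := by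
        rw [Nat.factorial_succ]
        push_cast
        rw [Real.log_mul (by positivity) (by positivity)]
      simp only [ha]
      rw [hI, hfac]
      simp only [mul_sub, Finset.sum_sub_distrib]
      simp only [logDerivs]
      push_cast
      ring
    rw [e]
    refine h.trans ?_
    have := mul_le_mul_of_nonneg_left (inv_pow_succ_le_sub hL hi1) (mul_nonneg hc0 hF0)
    simp only [hu]
    push_cast
    linarith
  refine ⟨2 * (c * F), by positivity, fun n hn => ?_⟩
  have := norm_sub_le_of_tendsto_of_telescoping ha0 hu0 hstep hn
  simp only [hu, mul_one_div] at this
  refine le_of_eq_of_le ?_ this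
  congr 1
  simp only [ha]
  ring

/-! ### The dilogarithm and its distribution relation -/

/-- The term `n = 0` vanishes because division by zero gives zero. Indexing by `n` itself lets the
multiples of `k` be singled out later. -/
theorem polylog_two_eq_tsum (z : ℂ) : polylog 2 z = ∑' n : ℕ, z ^ n / (n : ℂ) ^ 2 := by
  rw [← Nat.succ_injective.tsum_eq (f := fun n : ℕ => z ^ n / (n : ℂ) ^ 2)]
  · refine tsum_congr fun n => ?_
    have : (2 : ℂ) = ((2 : ℕ) : ℂ) := by norm_num
    rw [this, Complex.cpow_natCast]
    simp
  · intro n hn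
    cases n with
    | zero => simp at hn
    | succ n => exact ⟨n, rfl⟩

theorem norm_pow_div_sq_le {z : ℂ} (hz : ‖z‖ ≤ 1) (n : ℕ) :
    ‖z ^ n / (n : ℂ) ^ 2‖ ≤ 1 / (n : ℝ) ^ 2 := by
  rw [norm_div, norm_pow, norm_pow, Complex.norm_natCast]
  have := pow_le_one₀ (n := n) (norm_nonneg z) hz
  gcongr

theorem summable_pow_div_sq {z : ℂ} (hz : ‖z‖ ≤ 1) :
    Summable fun n : ℕ => z ^ n / (n : ℂ) ^ 2 :=
  Summable.of_norm_bounded (Real.summable_one_div_nat_pow.2 one_lt_two) (norm_pow_div_sq_le hz)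

theorem continuousOn_polylog_two : ContinuousOn (polylog 2) (Metric.closedBall 0 1) := by
  have : polylog 2 = fun z => ∑' n : ℕ, z ^ n / (n : ℂ) ^ 2 := funext polylog_two_eq_tsum
  rw [this]
  refine continuousOn_tsum (fun n => by fun_prop) (Real.summable_one_div_nat_pow.2 one_lt_two)
    fun n z hz => norm_pow_div_sq_le (by simpa using hz) n

theorem hasDerivAt_polylog_two {z : ℂ} (hz0 : z ≠ 0) (hz : ‖z‖ < 1) :
    HasDerivAt (polylog 2) (-Complex.log (1 - z) / z) z := by
  obtain ⟨r, hr, hr1⟩ := exists_between hz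
  have hr0 : 0 ≤ r := (norm_nonneg z).trans hr.le
  have hpoly : polylog 2 = fun z => ∑' n : ℕ, z ^ (n + 1) / ((n : ℂ) + 1) ^ 2 := by
    funext z
    have : (2 : ℂ) = ((2 : ℕ) : ℂ) := by norm_num
    simp only [polylog, this, Complex.cpow_natCast]
  have hn0 : ∀ n : ℕ, (n : ℂ) + 1 ≠ 0 := fun n => by exact_mod_cast n.succ_ne_zero
  have hd : HasDerivAt (fun w : ℂ => ∑' n : ℕ, w ^ (n + 1) / ((n : ℂ) + 1) ^ 2)
      (∑' n : ℕ, z ^ n / ((n : ℂ) + 1)) z := by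
    refine hasDerivAt_tsum_of_isPreconnected (𝕜 := ℂ) (u := fun n : ℕ => r ^ n)
      (summable_geometric_of_lt_one hr0 hr1) (t := Metric.ball (0 : ℂ) r) Metric.isOpen_ball
      (convex_ball (0 : ℂ) r).isPreconnected
      (g := fun n w => w ^ (n + 1) / ((n : ℂ) + 1) ^ 2)
      (g' := fun n w => w ^ n / ((n : ℂ) + 1)) (fun n w _ => ?_) (fun n w hw => ?_)
      (y₀ := 0) (Metric.mem_ball_self ((norm_nonneg z).trans_lt hr)) ?_ (by simpa using hr)
    · refine ((hasDerivAt_pow (n + 1) w).div_const _).congr_deriv ?_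
      have := hn0 n
      rw [Nat.add_sub_cancel]
      push_cast
      field_simp
    · have hw' : ‖w‖ ≤ r := by simpa using (Metric.mem_ball.1 hw).le
      have h3 : ‖(n : ℂ) + 1‖ = (n : ℝ) + 1 := by
        have := Complex.norm_natCast (n + 1)
        push_cast at this
        exact this
      rw [norm_div, norm_pow, h3]
      calc ‖w‖ ^ n / ((n : ℝ) + 1) ≤ ‖w‖ ^ n :=
            div_le_self (by positivity) (by linarith [(Nat.cast_nonneg n : (0 : ℝ) ≤ n)])
        _ ≤ r ^ n := by gcongr
    · simp [summable_zero]
  rw [hpoly]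
  refine hd.congr_deriv ?_
  rw [eq_div_iff hz0, ← (Complex.hasSum_taylorSeries_neg_log' hz).tsum_eq, ← tsum_mul_right]
  refine tsum_congr fun n => ?_
  ring

theorem IsPrimitiveRoot.sum_inv_pow_pow {k : ℕ} {ρ : ℂ} (hρ : IsPrimitiveRoot ρ k) (n : ℕ) :
    ∑ j ∈ Finset.range k, ((ρ ^ j)⁻¹) ^ n = if k ∣ n then (k : ℂ) else 0 := by
  have h : ∀ j, ((ρ ^ j)⁻¹) ^ n = ((ρ⁻¹) ^ n) ^ j := fun j => by
    rw [← inv_pow, ← pow_mul, ← pow_mul, mul_comm]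
  simp only [h]
  split_ifs with hk
  · rw [(hρ.inv.pow_eq_one_iff_dvd n).2 hk]
    simp
  · have h1 : (ρ⁻¹) ^ n ≠ 1 := fun h => hk ((hρ.inv.pow_eq_one_iff_dvd n).1 h)
    rw [geom_sum_eq h1, ← pow_mul, mul_comm, pow_mul, hρ.inv.pow_eq_one]
    simp

/-- Orthogonality of the `k`th roots of unity keeps only the terms with `k ∣ n`; writing `n = k m`
leaves `k / k^2 = 1 / k`. -/
theorem sum_polylog_two_eq {k : ℕ} (hk : 1 ≤ k) {ρ : ℂ} (hρ : IsPrimitiveRoot ρ k) {w : ℂ}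
    (hw : ‖w‖ ≤ 1) :
    ∑ j ∈ Finset.range k, polylog 2 ((ρ ^ j)⁻¹ * w) = polylog 2 (w ^ k) / k := by
  have hk0 : (k : ℂ) ≠ 0 := by exact_mod_cast (by omega : k ≠ 0)
  have hnorm : ∀ j, ‖(ρ ^ j)⁻¹ * w‖ ≤ 1 := fun j => by
    rw [norm_mul, norm_inv, norm_pow, hρ.norm'_eq_one (by omega)]
    simpa using hw
  simp only [polylog_two_eq_tsum]
  rw [← Summable.tsum_finsetSum fun j _ => summable_pow_div_sq (hnorm j)]
  have h1 : ∀ n : ℕ, ∑ j ∈ Finset.range k, ((ρ ^ j)⁻¹ * w) ^ n / (n : ℂ) ^ 2 =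
      (if k ∣ n then (k : ℂ) else 0) * (w ^ n / (n : ℂ) ^ 2) := fun n => by
    rw [← hρ.sum_inv_pow_pow n, Finset.sum_mul]
    refine Finset.sum_congr rfl fun j _ => ?_
    rw [mul_pow]
    ring
  simp only [h1]
  have hinj : Function.Injective fun n : ℕ => k * n := fun a b h =>
    Nat.eq_of_mul_eq_mul_left (by omega) h
  rw [← hinj.tsum_eq, ← tsum_div_const]
  · refine tsum_congr fun n => ?_
    rw [if_pos (dvd_mul_right k n), pow_mul]
    push_cast
    field_simp
  · intro n hn
    by_cases h : k ∣ n
    · obtain ⟨m, rfl⟩ := h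
      exact ⟨m, rfl⟩
    · simp [h] at hn

/-! ### Logarithmic integrals as dilogarithms -/

theorem norm_exp_lt_one {w : ℂ} (hw : w.re < 0) : ‖Complex.exp w‖ < 1 := by
  rw [Complex.norm_exp]
  exact Real.exp_lt_one_iff.2 hw

theorem re_one_sub_mul_exp_pos {ζ w : ℂ} (hζ : ‖ζ‖ = 1) (hw : w.re < 0) :
    0 < (1 - ζ * Complex.exp w).re := by
  have h := Complex.re_le_norm (ζ * Complex.exp w)
  rw [norm_mul, hζ, one_mul] at h
  have := norm_exp_lt_one hw
  simp only [Complex.sub_re, Complex.one_re]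
  linarith

theorem re_one_sub_pos_of_norm_eq_one {ζ : ℂ} (hζ : ‖ζ‖ = 1) (h1 : ζ ≠ 1) : 0 < (1 - ζ).re := by
  have h := Complex.re_le_norm ζ
  rw [hζ] at h
  rcases h.lt_or_eq with h | h
  · simpa using h
  · exfalso
    apply h1
    have h2 : ‖ζ‖ ^ 2 = 1 := by rw [hζ, one_pow]
    rw [Complex.sq_norm, Complex.normSq_apply, h] at h2
    apply Complex.ext
    · simpa using h
    · simpa using h2

theorem continuousOn_polylog_two_mul_exp {ζ w : ℂ} (hζ : ‖ζ‖ = 1) (hw : w.re < 0) (n : ℝ) :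
    ContinuousOn (fun x : ℝ => polylog 2 (ζ * Complex.exp (w * x))) (Icc 0 n) := by
  refine continuousOn_polylog_two.comp (by fun_prop) fun x hx => ?_
  rw [mem_closedBall_zero_iff, norm_mul, hζ, one_mul, Complex.norm_exp]
  refine Real.exp_le_one_iff.2 ?_
  rw [Complex.re_mul_ofReal]
  exact mul_nonpos_of_nonpos_of_nonneg hw.le hx.1

theorem hasDerivAt_polylog_two_mul_exp {ζ w : ℂ} (hζ : ‖ζ‖ = 1) (hw : w.re < 0) {x : ℝ}
    (hx : 0 < x) :
    HasDerivAt (fun x : ℝ => polylog 2 (ζ * Complex.exp (w * x)))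
      (-w * Complex.log (1 - ζ * Complex.exp (w * x))) x := by
  have hζ0 : ζ ≠ 0 := fun h => by simp [h] at hζ
  have hre : (w * x).re < 0 := by
    rw [Complex.re_mul_ofReal]
    exact mul_neg_of_neg_of_pos hw hx
  have hn0 : ζ * Complex.exp (w * x) ≠ 0 := mul_ne_zero hζ0 (Complex.exp_ne_zero _)
  have hn : ‖ζ * Complex.exp (w * x)‖ < 1 := by
    rw [norm_mul, hζ, one_mul]
    exact norm_exp_lt_one hre
  have h1 : HasDerivAt (fun y : ℝ => w * (y : ℂ)) w x := by
    simpa using ((hasDerivAt_id x).ofReal_comp).const_mul w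
  have h2 : HasDerivAt (fun y : ℝ => ζ * Complex.exp (w * y)) (ζ * (Complex.exp (w * x) * w)) x :=
    (h1.cexp).const_mul ζ
  refine ((hasDerivAt_polylog_two hn0 hn).comp x h2).congr_deriv ?_
  have := Complex.exp_ne_zero (w * x)
  field_simp

/-- The antiderivative is `-Li_2(ζ e^(w x)) / w`. At `x = 0` the argument lies on the unit circle,
so only continuity of `Li_2` on the closed disc is used there. -/
theorem integral_log_one_sub_mul_exp {ζ w : ℂ} (hζ : ‖ζ‖ = 1) (h1 : ζ ≠ 1) (hw : w.re < 0)
    {n : ℝ} (hn : 0 ≤ n) :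
    ∫ x in (0 : ℝ)..n, Complex.log (1 - ζ * Complex.exp (w * x)) =
      -(polylog 2 (ζ * Complex.exp (w * n)) - polylog 2 ζ) / w := by
  have hw0 : w ≠ 0 := fun h => by simp [h] at hw
  rw [intervalIntegral.integral_eq_sub_of_hasDerivAt_of_le hn
    (f := fun x : ℝ => -polylog 2 (ζ * Complex.exp (w * x)) / w)]
  · simp only [Complex.ofReal_zero, mul_zero, Complex.exp_zero, mul_one]
    ring
  · exact (continuousOn_polylog_two_mul_exp hζ hw n).neg.div_const w
  · intro x hx
    refine ((hasDerivAt_polylog_two_mul_exp hζ hw hx.1).neg.div_const w).congr_deriv ?_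
    field_simp
  · refine ContinuousOn.intervalIntegrable fun x hx => ?_
    rw [uIcc_of_le hn] at hx
    refine ContinuousAt.continuousWithinAt (ContinuousAt.clog (by fun_prop) (Or.inl ?_))
    rcases hx.1.lt_or_eq with h | h
    · refine re_one_sub_mul_exp_pos hζ ?_
      rw [Complex.re_mul_ofReal]
      exact mul_neg_of_neg_of_pos hw h
    · rw [← h]
      simpa using re_one_sub_pos_of_norm_eq_one hζ h1

/-- For `x > 0`, `log (-(w x)) = log x + log (-w)`, which accounts for the two extra terms. The
formula for `g` is needed only off the endpoint 0, where the two logarithms are individually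
singular. -/
theorem integral_eq_of_eq_log_one_sub_exp_sub_log {w : ℂ} (hw : w.re < 0) {n : ℝ} (hn : 0 ≤ n)
    {g : ℝ → ℂ} (hg : ContinuousOn g (Icc 0 n))
    (hg' : ∀ x : ℝ, 0 < x → g x = Complex.log (1 - Complex.exp (w * x)) - Complex.log (-(w * x))) :
    ∫ x in (0 : ℝ)..n, g x =
      -(polylog 2 (Complex.exp (w * n)) - polylog 2 1) / w - n * Complex.log (-w) -
        (n * Real.log n - n) := by
  have hw0 : w ≠ 0 := fun h => by simp [h] at hw
  have hc := continuousOn_polylog_two_mul_exp norm_one hw n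
  have hd := fun x hx => hasDerivAt_polylog_two_mul_exp norm_one hw (x := x) hx
  simp only [one_mul] at hc hd
  rw [intervalIntegral.integral_eq_sub_of_hasDerivAt_of_le hn
    (f := fun x : ℝ => -polylog 2 (Complex.exp (w * x)) / w - x * Complex.log (-w) -
      ((x * Real.log x - x : ℝ) : ℂ))]
  · simp only [Complex.ofReal_zero, mul_zero, Complex.exp_zero, zero_mul, sub_zero]
    push_cast
    ring
  · refine ((hc.neg.div_const w).sub (by fun_prop)).sub ?_
    exact (Complex.continuous_ofReal.comp
      (Real.continuous_mul_log.sub continuous_id)).continuousOn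
  · intro x hx
    have hx0 := hx.1
    have e1 : HasDerivAt (fun x : ℝ => (x : ℂ) * Complex.log (-w)) (1 * Complex.log (-w)) x :=
      ((hasDerivAt_id x).ofReal_comp).mul_const _
    have e2 : HasDerivAt (fun x : ℝ => ((x * Real.log x - x : ℝ) : ℂ)) ((Real.log x : ℝ) : ℂ) x := by
      refine HasDerivAt.ofReal_comp (((Real.hasDerivAt_mul_log hx0.ne').sub
        (hasDerivAt_id x)).congr_deriv ?_)
      simp
    refine ((((hd x hx0).neg.div_const w).sub e1).sub e2).congr_deriv ?_
    have e3 : -(w * (x : ℂ)) = (x : ℂ) * (-w) := by ring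
    rw [hg' x hx0, e3, Complex.log_ofReal_mul hx0 (neg_ne_zero.2 hw0)]
    field_simp
    ring
  · refine ContinuousOn.intervalIntegrable ?_
    rwa [uIcc_of_le hn]

/-! ### Euler-Maclaurin for holomorphic functions along a segment from the origin -/

theorem DifferentiableOn.hasDerivAt_iteratedDeriv {U : Set ℂ} (hU : IsOpen U) {Φ : ℂ → ℂ}
    (hΦ : DifferentiableOn ℂ Φ U) (m : ℕ) {w : ℂ} (hw : w ∈ U) :
    HasDerivAt (iteratedDeriv m Φ) (iteratedDeriv (m + 1) Φ w) w := by
  have h := (hΦ.analyticOnNhd hU).iterated_deriv m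
  rw [← iteratedDeriv_eq_iterate] at h
  rw [iteratedDeriv_succ]
  exact (h w hw).differentiableAt.hasDerivAt

theorem iteratedDeriv_eq_of_hasDerivAt {U : Set ℂ} (hU : IsOpen U) {Φ : ℂ → ℂ} {F : ℕ → ℂ → ℂ}
    (h0 : ∀ w ∈ U, Φ w = F 0 w) (hF : ∀ m, ∀ w ∈ U, HasDerivAt (F m) (F (m + 1) w) w) (m : ℕ) :
    ∀ w ∈ U, iteratedDeriv m Φ w = F m w := by
  induction m with
  | zero => simpa using h0
  | succ m ih =>
    intro w hw
    rw [iteratedDeriv_succ, EventuallyEq.deriv_eq (f := F m), (hF m w hw).deriv]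
    filter_upwards [hU.mem_nhds hw] with y hy using ih y hy

/-- Euler-Maclaurin for `x ↦ Φ (z x / n)` on `[0, n]`, uniformly for `z` in a compact set which is
star-shaped about the origin. -/
theorem exists_euler_maclaurin_bound (L : ℕ) {U K : Set ℂ} (hU : IsOpen U) {Φ : ℂ → ℂ}
    (hΦ : DifferentiableOn ℂ Φ U) (hK : IsCompact K) (hKU : K ⊆ U)
    (hstar : ∀ z ∈ K, ∀ s : ℝ, 0 ≤ s → s ≤ 1 → (s : ℂ) * z ∈ K) :
    ∃ c : ℝ, 0 ≤ c ∧ ∀ z ∈ K, ∀ n : ℕ, 1 ≤ n → ∀ t : ℝ, 0 ≤ t → t ≤ 1 →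
      ‖∑ i ∈ Finset.range n, Φ (z / n * ((i : ℂ) + t)) -
        ((∫ x in (0 : ℝ)..n, Φ (z / n * x)) + ∑ m ∈ Finset.range L,
          bernoulliNormalized (m + 1) t *
            ((z / n) ^ m * (iteratedDeriv m Φ z - iteratedDeriv m Φ 0)))‖ ≤ c / (n : ℝ) ^ L := by
  obtain ⟨c, hc0, hc⟩ := norm_sum_sub_euler_maclaurin_le L
  obtain ⟨R, hR⟩ := hK.exists_bound_of_continuousOn (f := id) continuousOn_id
  obtain ⟨S, hS⟩ := hK.exists_bound_of_continuousOn (f := iteratedDeriv (L + 1) Φ)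
    fun w hw => (hΦ.hasDerivAt_iteratedDeriv hU _ (hKU hw)).continuousAt.continuousWithinAt
  -- The chain rule gives `(|z| / n)^(L + 1)` in the derivative of order `L + 1`, and summing over
  -- `n` unit intervals loses one power of `n`.
  refine ⟨c * (|R| ^ (L + 1) * |S|), by positivity, fun z hz n hn t ht0 ht1 => ?_⟩
  have hn0 : (n : ℂ) ≠ 0 := by exact_mod_cast (by omega : n ≠ 0)
  have hnpos : (0 : ℝ) < n := by exact_mod_cast (by omega : 0 < n)
  have hmem : ∀ x ∈ Icc (0 : ℝ) n, z / n * x ∈ K := by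
    intro x hx
    have := hstar z hz (x / n) (div_nonneg hx.1 hnpos.le) ((div_le_one hnpos).2 hx.2)
    convert this using 1
    push_cast
    ring
  have h := hc (fun m x => (z / n) ^ m * iteratedDeriv m Φ (z / n * x)) n t
    ((|R| / n) ^ (L + 1) * |S|) ht0 ht1 ?_ ?_
  · have e1 : z / n * ((n : ℝ) : ℂ) = z := by
      push_cast
      field_simp
    simp only [pow_zero, one_mul, iteratedDeriv_zero, Complex.ofReal_add,
      Complex.ofReal_natCast, Complex.ofReal_zero, mul_zero, ← mul_sub] at h
    have e2 : z / n * (n : ℂ) = z := by field_simp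
    rw [e2] at h
    refine h.trans (le_of_eq ?_)
    rw [div_pow, pow_succ (n : ℝ)]
    field_simp
  · intro m x hx
    have h1 : HasDerivAt (fun y : ℝ => z / n * (y : ℂ)) (z / n) x := by
      simpa using ((hasDerivAt_id x).ofReal_comp).const_mul (z / (n : ℂ))
    refine (((hΦ.hasDerivAt_iteratedDeriv hU m (hKU (hmem x hx))).comp x h1).const_mul
      ((z / n) ^ m)).congr_deriv ?_
    ring
  · intro x hx
    rw [norm_mul, norm_pow, norm_div, Complex.norm_natCast]
    have h1 : ‖z‖ ≤ |R| := (hR z hz).trans (le_abs_self R)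
    have h2 := (hS _ (hmem x hx)).trans (le_abs_self S)
    gcongr

/-! ### Derivatives of the logarithmic summands -/

theorem hasDerivAt_polylogNonpos (m : ℕ) {z : ℂ} (hz : z ≠ 1) (hz0 : z ≠ 0) :
    HasDerivAt (polylogNonpos m) (polylogNonpos (m + 1) z / z) z := by
  have hd : ∀ m, DifferentiableOn ℂ (polylogNonpos m) {1}ᶜ := by
    intro m
    induction m with
    | zero =>
      intro w hw
      have : 1 - w ≠ 0 := sub_ne_zero.2 (Ne.symm hw)
      have h : DifferentiableAt ℂ (fun z : ℂ => z / (1 - z)) w :=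
        DifferentiableAt.div (by fun_prop) (by fun_prop) this
      exact h.differentiableWithinAt
    | succ m ih =>
      have e : polylogNonpos (m + 1) = fun z => z * deriv (polylogNonpos m) z := by
        simp only [polylogNonpos, Function.iterate_succ_apply']
      rw [e]
      exact differentiableOn_id.mul (ih.deriv isOpen_compl_singleton)
  have e : polylogNonpos (m + 1) z = z * deriv (polylogNonpos m) z := by
    simp only [polylogNonpos, Function.iterate_succ_apply']
  rw [e, mul_div_cancel_left₀ _ hz0]
  exact ((hd m).differentiableAt (isOpen_compl_singleton.mem_nhds hz)).hasDerivAt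

/-- The iterated derivatives of `w ↦ log (1 - ζ e^w)`. -/
noncomputable def logOneSubDerivs (ζ : ℂ) : ℕ → ℂ → ℂ
  | 0, w => Complex.log (1 - ζ * Complex.exp w)
  | m + 1, w => -polylogNonpos m (ζ * Complex.exp w)

theorem hasDerivAt_logOneSubDerivs {ζ : ℂ} (hζ : ζ ≠ 0) (m : ℕ) {w : ℂ}
    (hw : 1 - ζ * Complex.exp w ∈ Complex.slitPlane) :
    HasDerivAt (logOneSubDerivs ζ m) (logOneSubDerivs ζ (m + 1) w) w := by
  have hne : ζ * Complex.exp w ≠ 1 := fun h => by simp [h] at hw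
  have hne0 : ζ * Complex.exp w ≠ 0 := mul_ne_zero hζ (Complex.exp_ne_zero w)
  have h1 : HasDerivAt (fun w => ζ * Complex.exp w) (ζ * Complex.exp w) w :=
    (Complex.hasDerivAt_exp w).const_mul ζ
  cases m with
  | zero =>
    refine ((h1.const_sub 1).clog hw).congr_deriv ?_
    simp [logOneSubDerivs, polylogNonpos, neg_div]
  | succ m =>
    refine ((hasDerivAt_polylogNonpos m hne hne0).comp w h1).neg.congr_deriv ?_
    simp only [logOneSubDerivs]
    field_simp

/-- The iterated derivatives of `w ↦ log (-w)`. -/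
noncomputable def logNegDerivs : ℕ → ℂ → ℂ
  | 0, w => Complex.log (-w)
  | m + 1, w => (-1) ^ m * (Nat.factorial m : ℂ) / w ^ (m + 1)

theorem hasDerivAt_logNegDerivs (m : ℕ) {w : ℂ} (hw : w.re < 0) :
    HasDerivAt (logNegDerivs m) (logNegDerivs (m + 1) w) w := by
  have hw0 : w ≠ 0 := fun h => by simp [h] at hw
  cases m with
  | zero =>
    have hs : -w ∈ Complex.slitPlane := Or.inl (by simpa using hw)
    refine ((hasDerivAt_neg w).clog hs).congr_deriv ?_
    simp [logNegDerivs]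
  | succ m =>
    have h := ((hasDerivAt_pow (m + 1) w).fun_inv (pow_ne_zero _ hw0)).const_mul
      ((-1) ^ m * (Nat.factorial m : ℂ))
    refine (h.congr_deriv ?_).congr_of_eventuallyEq (Eventually.of_forall fun y => ?_)
    · simp only [logNegDerivs, Nat.factorial_succ]
      rw [Nat.add_sub_cancel]
      push_cast
      field_simp
      ring
    · simp [logNegDerivs, div_eq_mul_inv]

/-- Both arguments lie strictly within `π / 2` of zero, so their difference stays in the principal
range. -/
theorem log_div_of_re_pos {a b : ℂ} (ha : 0 < a.re) (hb : 0 < b.re) :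
    a / b ∈ Complex.slitPlane ∧ Complex.log (a / b) = Complex.log a - Complex.log b := by
  have ha0 : a ≠ 0 := fun h => by simp [h] at ha
  have hb0 : b ≠ 0 := fun h => by simp [h] at hb
  have h1 := abs_lt.1 (Complex.abs_arg_lt_pi_div_two_iff.2 (Or.inl ha))
  have h2 := abs_lt.1 (Complex.abs_arg_lt_pi_div_two_iff.2 (Or.inl hb))
  have him : (Complex.log a - Complex.log b).im = a.arg - b.arg := by
    simp [Complex.log_im]
  have hlog : Complex.log (a / b) = Complex.log a - Complex.log b := by
    have := Complex.log_exp (x := Complex.log a - Complex.log b) (by rw [him]; linarith)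
      (by rw [him]; linarith)
    rwa [Complex.exp_sub, Complex.exp_log ha0, Complex.exp_log hb0] at this
  refine ⟨Complex.mem_slitPlane_iff_arg.2 ⟨?_, div_ne_zero ha0 hb0⟩, hlog⟩
  rw [← Complex.log_im, hlog, him]
  linarith

/-! ### The regularized logarithm at the origin -/

/-- The entire function `(e^w - 1) / w`. -/
noncomputable def expQuot : ℂ → ℂ := dslope Complex.exp 0

theorem expQuot_zero : expQuot 0 = 1 := by
  simp [expQuot, dslope_same]

theorem expQuot_of_ne {w : ℂ} (hw : w ≠ 0) : expQuot w = (1 - Complex.exp w) / (-w) := by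
  rw [expQuot, dslope_of_ne _ hw, slope_def_field, Complex.exp_zero, sub_zero, ← neg_div_neg_eq,
    neg_sub]

theorem differentiable_expQuot : Differentiable ℂ expQuot := by
  rw [← differentiableOn_univ]
  exact (Complex.differentiableOn_dslope univ_mem).2 Complex.differentiable_exp.differentiableOn

theorem expQuot_mem_slitPlane_and_log {w : ℂ} (hw : w.re < 0) :
    expQuot w ∈ Complex.slitPlane ∧
      Complex.log (expQuot w) = Complex.log (1 - Complex.exp w) - Complex.log (-w) := by
  have hw0 : w ≠ 0 := fun h => by simp [h] at hw
  rw [expQuot_of_ne hw0]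
  refine log_div_of_re_pos ?_ (by simpa using hw)
  simpa using re_one_sub_mul_exp_pos norm_one hw

/-- The function `log ((e^w - 1) / w)`. -/
noncomputable def logExpQuot (w : ℂ) : ℂ := Complex.log (expQuot w)

theorem isOpen_expQuot_preimage_slitPlane : IsOpen (expQuot ⁻¹' Complex.slitPlane) :=
  Complex.isOpen_slitPlane.preimage differentiable_expQuot.continuous

theorem differentiableOn_logExpQuot :
    DifferentiableOn ℂ logExpQuot (expQuot ⁻¹' Complex.slitPlane) :=
  differentiable_expQuot.differentiableOn.clog fun _ hw => hw

theorem iteratedDeriv_logExpQuot (m : ℕ) {w : ℂ} (hw : w.re < 0) :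
    iteratedDeriv m logExpQuot w = logOneSubDerivs 1 m w - logNegDerivs m w := by
  refine iteratedDeriv_eq_of_hasDerivAt (U := {w : ℂ | w.re < 0})
    (isOpen_lt Complex.continuous_re continuous_const)
    (F := fun m w => logOneSubDerivs 1 m w - logNegDerivs m w) ?_ ?_ m w hw
  · intro w hw
    simpa [logOneSubDerivs, logNegDerivs, logExpQuot] using (expQuot_mem_slitPlane_and_log hw).2
  · intro m w hw
    exact (hasDerivAt_logOneSubDerivs one_ne_zero m
      (Or.inl (re_one_sub_mul_exp_pos norm_one hw))).sub (hasDerivAt_logNegDerivs m hw)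

theorem zero_mem_expQuot_preimage : (0 : ℂ) ∈ expQuot ⁻¹' Complex.slitPlane := by
  simp [expQuot_zero]

/-- From `(e^(-w) - 1) / (-w) = e^(-w) (e^w - 1) / w`; near 0 the imaginary parts are too small for
a branch change. Thus `logExpQuot w - w / 2` is even near 0. -/
theorem logExpQuot_neg_eventuallyEq :
    (fun w => logExpQuot (-w)) =ᶠ[𝓝 0] fun w => logExpQuot w - w := by
  have hc : ContinuousAt logExpQuot 0 := (differentiableOn_logExpQuot.differentiableAt
    (isOpen_expQuot_preimage_slitPlane.mem_nhds zero_mem_expQuot_preimage)).continuousAt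
  have h0 : logExpQuot 0 = 0 := by simp [logExpQuot, expQuot_zero]
  have h2 : ContinuousAt (fun w => (logExpQuot w - w).im) 0 :=
    Complex.continuous_im.continuousAt.comp (hc.sub continuousAt_id)
  have hpi := Real.pi_pos
  have e2 : ∀ᶠ w in 𝓝 (0 : ℂ), (logExpQuot w - w).im ∈ Ioo (-Real.pi) Real.pi := by
    refine h2.eventually_mem (Ioo_mem_nhds ?_ ?_) <;> simp [h0, hpi]
  have hU : ∀ᶠ w in 𝓝 (0 : ℂ), w ∈ expQuot ⁻¹' Complex.slitPlane :=
    isOpen_expQuot_preimage_slitPlane.mem_nhds zero_mem_expQuot_preimage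
  filter_upwards [e2, hU] with w h2 hw
  have hne : expQuot w ≠ 0 := Complex.slitPlane_ne_zero hw
  have key : expQuot (-w) = Complex.exp (logExpQuot w - w) := by
    rw [Complex.exp_sub, logExpQuot, Complex.exp_log hne]
    by_cases hw0 : w = 0
    · simp [hw0]
    · rw [expQuot_of_ne hw0, expQuot_of_ne (neg_ne_zero.2 hw0), Complex.exp_neg]
      have := Complex.exp_ne_zero w
      field_simp
      ring
  rw [logExpQuot, key, Complex.log_exp h2.1 h2.2.le]

/-- For even `m` the Bernoulli number `B_(m+1)` vanishes. For odd `m` the evenness of `logExpQuot w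
- w / 2` kills the derivative, except that it is `1 / 2` for `m = 1`; multiplied by `B_2 / 2! = 1 /
12` this is `1 / 24`. -/
theorem bernoulliNormalized_mul_iteratedDeriv_logExpQuot_zero {m : ℕ} (hm : 1 ≤ m) :
    bernoulliNormalized (m + 1) 1 * iteratedDeriv m logExpQuot 0 =
      if m = 1 then 1 / 24 else 0 := by
  have hb : bernoulliNormalized (m + 1) 1 =
      ((bernoulli (m + 1) : ℚ) : ℂ) / (Nat.factorial (m + 1) : ℂ) := by
    have h0 := bernoulliNormalized_ratCast (m + 1) 0
    rw [Rat.cast_zero] at h0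
    rw [bernoulliNormalized_apply_one (by omega), h0, Polynomial.bernoulli_eval_zero]
  rw [hb]
  rcases Nat.even_or_odd m with he | ho
  · rw [bernoulli_eq_zero_of_odd he.add_one (by omega), if_neg]
    · simp
    · rintro rfl
      simp at he
  · have hA : AnalyticAt ℂ logExpQuot 0 := differentiableOn_logExpQuot.analyticAt
      (isOpen_expQuot_preimage_slitPlane.mem_nhds zero_mem_expQuot_preimage)
    have h := logExpQuot_neg_eventuallyEq.iteratedDeriv_eq m
    rw [iteratedDeriv_comp_neg, neg_zero, iteratedDeriv_fun_sub (g := fun w => w) hA.contDiffAt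
      contDiffAt_id, iteratedDeriv_fun_id_zero, ho.neg_one_pow] at h
    have h' : iteratedDeriv m logExpQuot 0 = (if m = 1 then 1 else 0) / 2 := by
      rw [smul_eq_mul] at h
      linear_combination (-1 / 2 : ℂ) * h
    rw [h']
    split_ifs with h1
    · subst h1
      rw [bernoulli_two]
      norm_num [Nat.factorial]
    · simp

/-! ### Uniform estimates for each residue class -/

/-- A truncated closed sector in the left half plane. -/
def leftSector (κ C : ℝ) : Set ℂ := {w | w.re ≤ -(κ * ‖w‖) ∧ ‖w‖ ≤ C}

theorem isCompact_leftSector (κ C : ℝ) : IsCompact (leftSector κ C) := by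
  refine (isCompact_closedBall (0 : ℂ) C).of_isClosed_subset ?_ ?_
  · exact (isClosed_le Complex.continuous_re (continuous_const.mul continuous_norm).neg).inter
      (isClosed_le continuous_norm continuous_const)
  · intro w hw
    simpa using hw.2

theorem ofReal_mul_mem_leftSector {κ C : ℝ} {z : ℂ} (hz : z ∈ leftSector κ C) {s : ℝ}
    (hs0 : 0 ≤ s) (hs1 : s ≤ 1) : (s : ℂ) * z ∈ leftSector κ C := by
  have hn : ‖(s : ℂ) * z‖ = s * ‖z‖ := by
    rw [norm_mul, Complex.norm_real, Real.norm_of_nonneg hs0]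
  refine ⟨?_, ?_⟩
  · rw [hn, Complex.re_ofReal_mul]
    have := mul_le_mul_of_nonneg_left hz.1 hs0
    linarith
  · rw [hn]
    exact (mul_le_of_le_one_left (norm_nonneg z) hs1).trans hz.2

theorem re_neg_of_mem_leftSector {κ C : ℝ} (hκ : 0 < κ) {z : ℂ} (hz : z ∈ leftSector κ C)
    (hz0 : z ≠ 0) : z.re < 0 := by
  have := mul_pos hκ (norm_pos_iff.2 hz0)
  linarith [hz.1]

theorem exists_sum_log_one_sub_bound (L : ℕ) {κ C : ℝ} (hκ : 0 < κ) {ζ : ℂ} (hζ : ‖ζ‖ = 1)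
    (hζ1 : ζ ≠ 1) :
    ∃ c : ℝ, 0 ≤ c ∧ ∀ z ∈ leftSector κ C, z ≠ 0 → ∀ n : ℕ, 1 ≤ n → ∀ t : ℝ, 0 ≤ t → t ≤ 1 →
      ‖∑ i ∈ Finset.range n, Complex.log (1 - ζ * Complex.exp (z / n * ((i : ℂ) + t))) -
        (-(n / z) * (polylog 2 (ζ * Complex.exp z) - polylog 2 ζ) + ∑ m ∈ Finset.range L,
          bernoulliNormalized (m + 1) t *
            ((z / n) ^ m * (logOneSubDerivs ζ m z - logOneSubDerivs ζ m 0)))‖ ≤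
        c / (n : ℝ) ^ L := by
  have hζ0 : ζ ≠ 0 := fun h => by simp [h] at hζ
  set U : Set ℂ := (fun w => 1 - ζ * Complex.exp w) ⁻¹' Complex.slitPlane with hU
  have hUo : IsOpen U := Complex.isOpen_slitPlane.preimage (by fun_prop)
  have hder : ∀ m, ∀ w ∈ U,
      HasDerivAt (logOneSubDerivs ζ m) (logOneSubDerivs ζ (m + 1) w) w :=
    fun m w hw => hasDerivAt_logOneSubDerivs hζ0 m hw
  have hsub : leftSector κ C ⊆ U := by
    intro w hw
    refine Or.inl ?_
    by_cases hw0 : w = 0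
    · subst hw0
      simpa using re_one_sub_pos_of_norm_eq_one hζ hζ1
    · exact re_one_sub_mul_exp_pos hζ (re_neg_of_mem_leftSector hκ hw hw0)
  obtain ⟨c, hc0, hc⟩ := exists_euler_maclaurin_bound L hUo (Φ := logOneSubDerivs ζ 0)
    (fun w hw => (hder 0 w hw).differentiableAt.differentiableWithinAt)
    (isCompact_leftSector κ C) hsub fun z hz s => ofReal_mul_mem_leftSector hz
  have hit := iteratedDeriv_eq_of_hasDerivAt hUo (fun w _ => rfl) hder
  refine ⟨c, hc0, fun z hz hz0 n hn t ht0 ht1 => ?_⟩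
  have hn0 : (n : ℂ) ≠ 0 := by exact_mod_cast (by omega : n ≠ 0)
  have hnpos : (0 : ℝ) < n := by exact_mod_cast (by omega : 0 < n)
  have hzre := re_neg_of_mem_leftSector hκ hz hz0
  have h := hc z hz n hn t ht0 ht1
  have hw : (z / (n : ℂ)).re < 0 := by
    rw [Complex.div_natCast_re]
    exact div_neg_of_neg_of_pos hzre hnpos
  have hmem0 : (0 : ℂ) ∈ U := by
    refine Or.inl ?_
    simpa using re_one_sub_pos_of_norm_eq_one hζ hζ1
  simp only [hit _ z (hsub hz), hit _ 0 hmem0] at h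
  have hI := integral_log_one_sub_mul_exp hζ hζ1 hw hnpos.le
  have e2 : z / n * ((n : ℝ) : ℂ) = z := by
    push_cast
    field_simp
  rw [e2] at hI
  have hI' : ∫ x in (0 : ℝ)..n, logOneSubDerivs ζ 0 (z / n * x) =
      -(n / z) * (polylog 2 (ζ * Complex.exp z) - polylog 2 ζ) := by
    simp only [logOneSubDerivs]
    rw [hI]
    field_simp
  rw [hI'] at h
  exact h

theorem exists_sum_logExpQuot_bound (L : ℕ) {κ C : ℝ} (hκ : 0 < κ) :
    ∃ c : ℝ, 0 ≤ c ∧ ∀ z ∈ leftSector κ C, z ≠ 0 → ∀ n : ℕ, 1 ≤ n →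
      ‖∑ i ∈ Finset.range n, logExpQuot (z / n * ((i : ℂ) + 1)) -
        (-(n / z) * (polylog 2 (Complex.exp z) - polylog 2 1) - n * Complex.log (-(z / n)) -
          (n * Real.log n - n) + ∑ m ∈ Finset.range L,
          bernoulliNormalized (m + 1) 1 *
            ((z / n) ^ m * (iteratedDeriv m logExpQuot z - iteratedDeriv m logExpQuot 0)))‖ ≤
        c / (n : ℝ) ^ L := by
  have hsub : leftSector κ C ⊆ expQuot ⁻¹' Complex.slitPlane := by
    intro w hw
    by_cases hw0 : w = 0
    · subst hw0
      exact zero_mem_expQuot_preimage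
    · exact (expQuot_mem_slitPlane_and_log (re_neg_of_mem_leftSector hκ hw hw0)).1
  obtain ⟨c, hc0, hc⟩ := exists_euler_maclaurin_bound L isOpen_expQuot_preimage_slitPlane
    differentiableOn_logExpQuot
    (isCompact_leftSector κ C) hsub fun z hz s => ofReal_mul_mem_leftSector hz
  refine ⟨c, hc0, fun z hz hz0 n hn => ?_⟩
  have hn0 : (n : ℂ) ≠ 0 := by exact_mod_cast (by omega : n ≠ 0)
  have hnpos : (0 : ℝ) < n := by exact_mod_cast (by omega : 0 < n)
  have hzre := re_neg_of_mem_leftSector hκ hz hz0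
  have h := hc z hz n hn 1 zero_le_one le_rfl
  have hw : (z / (n : ℂ)).re < 0 := by
    rw [Complex.div_natCast_re]
    exact div_neg_of_neg_of_pos hzre hnpos
  have hI := integral_eq_of_eq_log_one_sub_exp_sub_log hw hnpos.le
    (g := fun x : ℝ => logExpQuot (z / n * x)) ?_ ?_
  · have e2 : z / n * ((n : ℝ) : ℂ) = z := by
      push_cast
      field_simp
    rw [e2] at hI
    have e3 : -(polylog 2 (Complex.exp z) - polylog 2 1) / (z / n) =
        -(n / z) * (polylog 2 (Complex.exp z) - polylog 2 1) := by
      field_simp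
    rw [hI, e3] at h
    simpa only [Complex.ofReal_one, Complex.ofReal_natCast] using h
  · intro x hx
    have hm := ofReal_mul_mem_leftSector hz (s := x / n) (div_nonneg hx.1 hnpos.le)
      ((div_le_one hnpos).2 hx.2)
    have e : ((x / n : ℝ) : ℂ) * z = z / n * x := by
      push_cast
      ring
    rw [e] at hm
    have h1 : ContinuousAt logExpQuot (z / n * x) :=
      (differentiableOn_logExpQuot.differentiableAt
        (isOpen_expQuot_preimage_slitPlane.mem_nhds (hsub hm))).continuousAt
    have h2 : ContinuousAt (fun y : ℝ => z / n * (y : ℂ)) x := by fun_prop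
    exact (ContinuousAt.comp (f := fun y : ℝ => z / n * (y : ℂ)) h1 h2).continuousWithinAt
  · intro x hx
    refine (expQuot_mem_slitPlane_and_log ?_).2
    rw [Complex.re_mul_ofReal]
    exact mul_neg_of_neg_of_pos hw hx

theorem sum_range_eq_add_Ico_one (f : ℕ → ℂ) {L : ℕ} (hL : 1 ≤ L) :
    ∑ m ∈ Finset.range L, f m = f 0 + ∑ m ∈ Finset.Ico 1 L, f m := by
  rw [Finset.range_eq_Ico, Finset.sum_eq_sum_Ico_succ_bot hL]

/-- The left side is a logarithm of the product for `ζ = 1`. Adding Stirling's series cancels `n log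
(-(z / n))`, `n log n - n` and every higher contribution of `log (-w)`. -/
theorem exists_sum_logExpQuot_add_log_factorial_bound {L : ℕ} (hL : 1 ≤ L) {κ C : ℝ}
    (hκ : 0 < κ) :
    ∃ c : ℝ, 0 ≤ c ∧ ∀ z ∈ leftSector κ C, z ≠ 0 → ∀ n : ℕ, 1 ≤ n →
      ‖(n * Complex.log (-(z / n)) + Real.log (Nat.factorial n) +
          ∑ i ∈ Finset.range n, logExpQuot (z / n * ((i : ℂ) + 1))) -
        (-(n / z) * (polylog 2 (Complex.exp z) - polylog 2 1) +
          1 / 2 * (Real.log (2 * Real.pi) + logExpQuot z + Real.log n) +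
          ∑ m ∈ Finset.Ico 1 L, (bernoulliNormalized (m + 1) 1 *
            ((z / n) ^ m * logOneSubDerivs 1 m z) - if m = 1 then z / n / 24 else 0))‖ ≤
        c / (n : ℝ) ^ L := by
  obtain ⟨c₁, hc₁, h₁⟩ := exists_sum_logExpQuot_bound L (C := C) hκ
  obtain ⟨c₂, hc₂, h₂⟩ := stirling_series hL
  refine ⟨c₁ + c₂, by positivity, fun z hz hz0 n hn => ?_⟩
  have hn0 : (n : ℂ) ≠ 0 := by exact_mod_cast (by omega : n ≠ 0)
  have hzre := re_neg_of_mem_leftSector hκ hz hz0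
  have h := (norm_add_le _ _).trans (add_le_add (h₁ z hz hz0 n hn) (h₂ n hn))
  rw [← add_div] at h
  refine le_of_eq_of_le ?_ h
  congr 1
  have hterm : ∀ m ∈ Finset.Ico 1 L, bernoulliNormalized (m + 1) 1 *
      ((z / n) ^ m * logOneSubDerivs 1 m z) - (if m = 1 then z / n / 24 else 0) =
      bernoulliNormalized (m + 1) 1 *
        ((z / n) ^ m * (iteratedDeriv m logExpQuot z - iteratedDeriv m logExpQuot 0)) +
        bernoulliNormalized (m + 1) 1 * logDerivs m n := by
    intro m hm
    have hm1 := (Finset.mem_Ico.1 hm).1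
    have hb := bernoulliNormalized_mul_iteratedDeriv_logExpQuot_zero hm1
    -- By homogeneity the endpoint derivative of `log (-w)`, after scaling, no longer depends on
    -- `z`; it is exactly the Stirling correction.
    have hl : (z / n) ^ m * logNegDerivs m z = logDerivs m n := by
      obtain ⟨p, rfl⟩ : ∃ p, m = p + 1 := ⟨m - 1, by omega⟩
      simp only [logNegDerivs, logDerivs, div_pow]
      push_cast
      field_simp
    have hif : (if m = 1 then z / n / 24 else 0) =
        (z / n) ^ m * (if m = 1 then (1 / 24 : ℂ) else 0) := by
      split_ifs with h1
      · subst h1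
        ring
      · simp
    rw [hif, ← hb, ← hl, iteratedDeriv_logExpQuot m hzre]
    ring
  rw [Finset.sum_congr rfl hterm, Finset.sum_add_distrib, sum_range_eq_add_Ico_one _ hL,
    sum_range_eq_add_Ico_one _ hL]
  have h0 : logExpQuot 0 = 0 := by simp [logExpQuot, expQuot_zero]
  simp only [zero_add, bernoulliNormalized_one, iteratedDeriv_zero, h0, logDerivs]
  push_cast
  ring

/-! ### Splitting the product into residue classes -/

theorem prod_one_sub_exp_eq {w : ℂ} (hw : w.re < 0) (n : ℕ) :
    ∏ i ∈ Finset.range n, (1 - Complex.exp (w * ((i : ℂ) + 1))) =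
      Complex.exp (n * Complex.log (-w) + Real.log (Nat.factorial n) +
        ∑ i ∈ Finset.range n, logExpQuot (w * ((i : ℂ) + 1))) := by
  have hw0 : w ≠ 0 := fun h => by simp [h] at hw
  have hterm : ∀ i : ℕ, 1 - Complex.exp (w * ((i : ℂ) + 1)) =
      (-w) * ((i + 1 : ℕ) : ℂ) * Complex.exp (logExpQuot (w * ((i : ℂ) + 1))) := by
    intro i
    have hi : (i : ℂ) + 1 ≠ 0 := by exact_mod_cast i.succ_ne_zero
    have hre : (w * ((i : ℂ) + 1)).re < 0 := by
      have : (w * ((i : ℂ) + 1)) = w * ((i + 1 : ℝ) : ℂ) := by push_cast; ring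
      rw [this, Complex.re_mul_ofReal]
      exact mul_neg_of_neg_of_pos hw (by positivity)
    rw [logExpQuot, Complex.exp_log (Complex.slitPlane_ne_zero
      (expQuot_mem_slitPlane_and_log hre).1), expQuot_of_ne (mul_ne_zero hw0 hi)]
    push_cast
    field_simp
  rw [Finset.prod_congr rfl fun i _ => hterm i, Finset.prod_mul_distrib, Finset.prod_mul_distrib,
    Finset.prod_const, Finset.card_range, ← Nat.cast_prod, Finset.prod_range_add_one_eq_factorial,
    Complex.exp_add, Complex.exp_add, Complex.exp_sum, Complex.exp_nat_mul,
    Complex.exp_log (neg_ne_zero.2 hw0), ← Complex.ofReal_exp,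
    Real.exp_log (by positivity)]
  simp

theorem prod_one_sub_mul_exp_eq {ζ w : ℂ} (hζ : ‖ζ‖ = 1) (hw : w.re < 0) {t : ℝ} (ht : 0 < t)
    (n : ℕ) :
    ∏ i ∈ Finset.range n, (1 - ζ * Complex.exp (w * ((i : ℂ) + t))) =
      Complex.exp (∑ i ∈ Finset.range n,
        Complex.log (1 - ζ * Complex.exp (w * ((i : ℂ) + t)))) := by
  rw [Complex.exp_sum]
  refine Finset.prod_congr rfl fun i _ => ?_
  have hre : (w * ((i : ℂ) + t)).re < 0 := by
    have : (w * ((i : ℂ) + t)) = w * ((i + t : ℝ) : ℂ) := by push_cast; ring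
    rw [this, Complex.re_mul_ofReal]
    exact mul_neg_of_neg_of_pos hw (by positivity)
  have hpos := re_one_sub_mul_exp_pos hζ hre
  rw [Complex.exp_log fun h => by simp [h] at hpos]

/-- Counting down from the multiples of `k` never truncates the subtraction, since `j < k`, and
makes all later offsets `1 - j / k` lie in `(0, 1]`. -/
theorem prod_Icc_mul_eq_prod_range_prod_range (f : ℕ → ℂ) (k n : ℕ) :
    ∏ m ∈ Finset.Icc 1 (k * n), f m =
      ∏ j ∈ Finset.range k, ∏ i ∈ Finset.range n, f (k * (i + 1) - j) := by
  have h : ∀ N, ∏ m ∈ Finset.Icc 1 N, f m = ∏ x ∈ Finset.range N, f (x + 1) := fun N => by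
    rw [Finset.range_eq_Ico, Finset.prod_Ico_add' f 0 N 1]
    rfl
  rw [h, Finset.prod_comm]
  induction n with
  | zero => simp
  | succ n ih =>
    rw [Nat.mul_succ, Finset.prod_range_add, ih, Finset.prod_range_succ]
    congr 1
    rw [← Finset.prod_range_reflect]
    refine Finset.prod_congr rfl fun j hj => ?_
    have := Finset.mem_range.1 hj
    congr 1
    rw [Nat.mul_succ]
    omega

theorem qProd_eq_prod {k n : ℕ} (hk : 1 ≤ k) (hn : 1 ≤ n) {ρ : ℂ} (hρ : IsPrimitiveRoot ρ k)
    (z : ℂ) :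
    qProd (ρ * Complex.exp (z / ((k * n : ℕ) : ℂ))) (k * n) =
      ∏ j ∈ Finset.range k, ∏ i ∈ Finset.range n,
        (1 - (ρ ^ j)⁻¹ * Complex.exp (z / n * ((i : ℂ) + ((1 - j / k : ℝ) : ℂ)))) := by
  have hk0 : (k : ℂ) ≠ 0 := by exact_mod_cast (by omega : k ≠ 0)
  have hn0 : (n : ℂ) ≠ 0 := by exact_mod_cast (by omega : n ≠ 0)
  have hρ0 : ρ ≠ 0 := hρ.ne_zero (by omega)
  rw [qProd, prod_Icc_mul_eq_prod_range_prod_range]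
  refine Finset.prod_congr rfl fun j hj => Finset.prod_congr rfl fun i _ => ?_
  have hjk : j ≤ k * (i + 1) := by nlinarith [Finset.mem_range.1 hj]
  rw [mul_pow, pow_sub₀ ρ hρ0 hjk, pow_mul, hρ.pow_eq_one, one_pow, one_mul, ← Complex.exp_nat_mul,
    Nat.cast_sub hjk]
  congr 3
  push_cast
  field_simp
  ring

/-! ### Identifying the main terms -/

theorem exp_neg_half_logs_eq_cpow_mul_cpow {z : ℂ} (hz : z.re < 0) {n : ℕ} (hn : 1 ≤ n) :
    Complex.exp (-(1 / 2 * (Real.log (2 * Real.pi) + logExpQuot z + Real.log n))) =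
      (1 / (n : ℂ)) ^ (1 / 2 : ℂ) *
        (-z / (2 * (Real.pi : ℂ) * (1 - Complex.exp z))) ^ (1 / 2 : ℂ) := by
  have hz0 : z ≠ 0 := fun h => by simp [h] at hz
  have hpos : 0 < (1 - Complex.exp z).re := by simpa using re_one_sub_mul_exp_pos norm_one hz
  have hne : 1 - Complex.exp z ≠ 0 := fun h => by simp [h] at hpos
  have hnpos : (0 : ℝ) < n := by exact_mod_cast (by omega : 0 < n)
  have hn0 : (n : ℂ) ≠ 0 := by exact_mod_cast (by omega : n ≠ 0)
  have hpi : (0 : ℝ) < 2 * Real.pi := by positivity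
  have hq := log_div_of_re_pos (a := -z) (b := 1 - Complex.exp z) (by simpa using hz) hpos
  have e1 : -z / (2 * (Real.pi : ℂ) * (1 - Complex.exp z)) =
      (((2 * Real.pi)⁻¹ : ℝ) : ℂ) * (-z / (1 - Complex.exp z)) := by
    push_cast
    have : (Real.pi : ℂ) ≠ 0 := by exact_mod_cast Real.pi_pos.ne'
    field_simp
  have e2 : Complex.log (1 / (n : ℂ)) = -(Real.log n : ℂ) := by
    have : (1 / (n : ℂ)) = (((n : ℝ)⁻¹ : ℝ) : ℂ) := by push_cast; simp
    rw [this, ← Complex.ofReal_log (by positivity), Real.log_inv]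
    simp
  have e3 : Complex.log (-z / (2 * (Real.pi : ℂ) * (1 - Complex.exp z))) =
      -(Real.log (2 * Real.pi) : ℂ) - logExpQuot z := by
    rw [e1, Complex.log_ofReal_mul (by positivity) (div_ne_zero (neg_ne_zero.2 hz0) hne), hq.2,
      Real.log_inv, logExpQuot, (expQuot_mem_slitPlane_and_log hz).2]
    push_cast
    ring
  have hne3 : -z / (2 * (Real.pi : ℂ) * (1 - Complex.exp z)) ≠ 0 := by
    rw [e1]
    refine mul_ne_zero ?_ (div_ne_zero (neg_ne_zero.2 hz0) hne)
    exact_mod_cast (inv_pos.2 hpi).ne'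
  rw [Complex.cpow_def_of_ne_zero (one_div_ne_zero hn0), Complex.cpow_def_of_ne_zero hne3, e2, e3,
    ← Complex.exp_add]
  congr 1
  ring

/-- Here `-B_1(1 - s) = s - 1 / 2` is the exponent, and the principal logarithm of the quotient
splits because both parts lie in the right half plane. -/
theorem exp_neg_bernoulliNormalized_one_mul {ζ z : ℂ} (hζ : ‖ζ‖ = 1) (hζ1 : ζ ≠ 1)
    (hz : z.re < 0) (s : ℝ) :
    Complex.exp (-(bernoulliNormalized 1 (1 - s) *
      (logOneSubDerivs ζ 0 z - logOneSubDerivs ζ 0 0))) =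
      ((1 - ζ * Complex.exp z) / (1 - ζ)) ^ ((s : ℂ) - 1 / 2) := by
  have h1 := re_one_sub_mul_exp_pos hζ hz
  have h2 := re_one_sub_pos_of_norm_eq_one hζ hζ1
  have hq := log_div_of_re_pos h1 h2
  rw [Complex.cpow_def_of_ne_zero (Complex.slitPlane_ne_zero hq.1), hq.2, bernoulliNormalized_one]
  simp only [logOneSubDerivs, Complex.exp_zero, mul_one]
  congr 1
  push_cast
  ring

/-- The sign `(-1)^(m+1)` is the reflection `B_(m+1)(1 - x) = (-1)^(m+1) B_(m+1)(x)`, and `k z / N =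
z / n`. For `m = 1` the `1 / 12` over `2!` is the `1 / 24` found at the origin. -/
theorem fFun_div_pow_eq {k n : ℕ} (hk : 1 ≤ k) (hn : 1 ≤ n) (ρ z : ℂ) {m : ℕ} (hm : 1 ≤ m) :
    fFun k ρ m z / ((k * n : ℕ) : ℂ) ^ m =
      -(bernoulliNormalized (m + 1) 1 * ((z / n) ^ m * logOneSubDerivs 1 m z) -
          if m = 1 then z / n / 24 else 0) -
        ∑ j ∈ Finset.Ico 1 k, bernoulliNormalized (m + 1) (1 - j / k) *
          ((z / n) ^ m * (logOneSubDerivs (ρ ^ j)⁻¹ m z - logOneSubDerivs (ρ ^ j)⁻¹ m 0)) := by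
  have hk0 : (k : ℂ) ≠ 0 := by exact_mod_cast (by omega : k ≠ 0)
  have hn0 : (n : ℂ) ≠ 0 := by exact_mod_cast (by omega : n ≠ 0)
  have hF : (Nat.factorial (m + 1) : ℂ) ≠ 0 := by exact_mod_cast (m + 1).factorial_ne_zero
  obtain ⟨p, rfl⟩ : ∃ p, m = p + 1 := ⟨m - 1, by omega⟩
  have hb : ∀ j : ℕ, bernoulliNormalized (p + 1 + 1) (1 - j / k) = (-1) ^ (p + 1 + 1) *
      (((Polynomial.bernoulli (p + 1 + 1)).eval ((j : ℚ) / (k : ℚ)) : ℚ) : ℂ) /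
        (Nat.factorial (p + 1 + 1) : ℂ) := by
    intro j
    have h := bernoulliNormalized_ratCast (p + 1 + 1) (1 - (j : ℚ) / k)
    rw [Polynomial.bernoulli_eval_one_sub] at h
    push_cast at h
    exact h
  have hb1 : bernoulliNormalized (p + 1 + 1) 1 = (-1) ^ (p + 1 + 1) *
      ((bernoulli (p + 1 + 1) : ℚ) : ℂ) / (Nat.factorial (p + 1 + 1) : ℂ) := by
    have h := hb 0
    simpa using h
  have hpow : ((k : ℂ) * z) ^ (p + 1) / ((k * n : ℕ) : ℂ) ^ (p + 1) = (z / n) ^ (p + 1) := by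
    rw [← div_pow]
    congr 1
    push_cast
    field_simp
  have hif : (if p + 1 = 1 then z / n / 24 else 0) = (-1) ^ (p + 1 + 1) * (z / n) ^ (p + 1) /
      (Nat.factorial (p + 1 + 1) : ℂ) * (if p + 1 = 1 then (1 / 12 : ℂ) else 0) := by
    split_ifs with h1
    · obtain rfl : p = 0 := by omega
      norm_num [Nat.factorial]
      ring
    · simp
  have hsum : ∑ j ∈ Finset.Ico 1 k, bernoulliNormalized (p + 1 + 1) (1 - j / k) *
      ((z / n) ^ (p + 1) *
        (logOneSubDerivs (ρ ^ j)⁻¹ (p + 1) z - logOneSubDerivs (ρ ^ j)⁻¹ (p + 1) 0)) =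
      -((-1) ^ (p + 1 + 1) * (z / n) ^ (p + 1) / (Nat.factorial (p + 1 + 1) : ℂ) *
        ∑ j ∈ Finset.Ico 1 k,
          (((Polynomial.bernoulli (p + 1 + 1)).eval ((j : ℚ) / (k : ℚ)) : ℚ) : ℂ) *
            (polylogNonpos p ((ρ ^ j)⁻¹ * Complex.exp z) - polylogNonpos p ((ρ ^ j)⁻¹))) := by
    rw [Finset.mul_sum, ← Finset.sum_neg_distrib]
    refine Finset.sum_congr rfl fun j _ => ?_
    rw [hb j]
    simp only [logOneSubDerivs, Complex.exp_zero, mul_one]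
    ring
  rw [hsum, hif, hb1, ← hpow, fFun]
  simp only [logOneSubDerivs, one_mul, Nat.add_sub_cancel]
  ring

/-- The dilogarithm terms for all residues modulo `k` add up to `(N / k) p(k z)`. -/
theorem mul_sum_polylog_two_sub_eq {k n : ℕ} (hk : 1 ≤ k) {ρ z : ℂ} (hρ : IsPrimitiveRoot ρ k)
    (hz : z.re < 0) :
    n / z * ((polylog 2 (Complex.exp z) - polylog 2 1) + ∑ j ∈ Finset.Ico 1 k,
      (polylog 2 ((ρ ^ j)⁻¹ * Complex.exp z) - polylog 2 (ρ ^ j)⁻¹)) =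
      ((k * n : ℕ) : ℂ) / k * pFun (k * z) := by
  have hk0 : (k : ℂ) ≠ 0 := by exact_mod_cast (by omega : k ≠ 0)
  have hz0 : z ≠ 0 := fun h => by simp [h] at hz
  have h1 := sum_polylog_two_eq hk hρ (norm_exp_lt_one hz).le
  have h2 := sum_polylog_two_eq hk hρ (w := 1) (by simp)
  rw [sum_range_eq_add_Ico_one _ hk] at h1 h2
  simp only [pow_zero, inv_one, one_mul, mul_one, one_pow] at h1 h2
  rw [← Complex.exp_nat_mul] at h1
  have h3 : (polylog 2 (Complex.exp z) - polylog 2 1) + ∑ j ∈ Finset.Ico 1 k,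
      (polylog 2 ((ρ ^ j)⁻¹ * Complex.exp z) - polylog 2 (ρ ^ j)⁻¹) =
      (polylog 2 (Complex.exp (k * z)) - polylog 2 1) / k := by
    rw [Finset.sum_sub_distrib]
    linear_combination h1 - h2
  rw [h3, pFun]
  push_cast
  field_simp

/-! ### Assembly of the asymptotic expansion -/

/-- The constant `K` depends only on `k`, `L`, `δ` and `C`; the complex number `E` is the quantity
written `O(N^{-L})` in the exponent. -/
theorem theorem4p1 (k : ℕ) (hk : 1 ≤ k) (L : ℕ) (hL : 1 ≤ L) (δ C : ℝ) (hδ : 0 < δ) :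
    ∃ K : ℝ, ∀ ρ : ℂ, IsPrimitiveRoot ρ k → ∀ N : ℕ, 1 ≤ N → k ∣ N →
      ∀ z : ℂ, z.re ≤ -δ → ‖z‖ ≤ C →
        ∃ E : ℂ, ‖E‖ ≤ K / (N : ℝ) ^ L ∧
          1 / qProd (ρ * Complex.exp (z / (N : ℂ))) N =
            ((k : ℂ) / (N : ℂ)) ^ (1 / 2 : ℂ) * gFun k ρ z *
              Complex.exp ((N : ℂ) / (k : ℂ) * pFun ((k : ℂ) * z) +
                ∑ ℓ ∈ Finset.Ico 1 L, fFun k ρ ℓ z / (N : ℂ) ^ ℓ + E) := by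
  -- This keeps the denominator of `κ = δ / C'` positive for any real `C`; then `Re z ≤ -δ ≤ -κ
  -- ‖z‖`, so `z` lies in the sector.
  set C' : ℝ := max C 1 with hC'
  have hC'0 : 0 < C' := lt_of_lt_of_le one_pos (le_max_right _ _)
  set κ : ℝ := δ / C' with hκ_def
  have hκ : 0 < κ := div_pos hδ hC'0
  obtain ⟨c₀, hc₀, h₀⟩ := exists_sum_logExpQuot_add_log_factorial_bound hL (C := C') hκ
  -- The conditions on `ζ` sit inside the existential so that a constant can be chosen for every `ζ`
  -- before `ρ` is introduced.
  have hA : ∀ ζ : ℂ, ∃ c : ℝ, 0 ≤ c ∧ (‖ζ‖ = 1 → ζ ≠ 1 → ∀ z ∈ leftSector κ C', z ≠ 0 →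
      ∀ n : ℕ, 1 ≤ n → ∀ t : ℝ, 0 ≤ t → t ≤ 1 →
      ‖∑ i ∈ Finset.range n, Complex.log (1 - ζ * Complex.exp (z / n * ((i : ℂ) + t))) -
        (-(n / z) * (polylog 2 (ζ * Complex.exp z) - polylog 2 ζ) + ∑ m ∈ Finset.range L,
          bernoulliNormalized (m + 1) t *
            ((z / n) ^ m * (logOneSubDerivs ζ m z - logOneSubDerivs ζ m 0)))‖ ≤
        c / (n : ℝ) ^ L) := by
    intro ζ
    by_cases h : ‖ζ‖ = 1 ∧ ζ ≠ 1
    · obtain ⟨c, hc0, hc⟩ := exists_sum_log_one_sub_bound L (C := C') hκ h.1 h.2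
      exact ⟨c, hc0, fun _ _ => hc⟩
    · exact ⟨0, le_rfl, fun h1 h2 => (h ⟨h1, h2⟩).elim⟩
  choose c hc hcb using hA
  -- Summing over all `k`th roots of unity dominates the constant of each `ρ^(-j)` independently of
  -- `ρ`.
  set c₁ : ℝ := ∑ ζ ∈ Polynomial.nthRootsFinset k (1 : ℂ), c ζ with hc₁
  -- The factor `k ^ L` converts `n^(-L)` into `N^(-L)`.
  refine ⟨(c₀ + k * c₁) * k ^ L, fun ρ hρ N hN hkN z hzre hzC => ?_⟩
  obtain ⟨n, rfl⟩ := hkN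
  have hn : 1 ≤ n := by
    rcases Nat.eq_zero_or_pos n with h | h
    · simp [h] at hN
    · exact h
  have hk0 : (k : ℂ) ≠ 0 := by exact_mod_cast (by omega : k ≠ 0)
  have hn0 : (n : ℂ) ≠ 0 := by exact_mod_cast (by omega : n ≠ 0)
  have hkpos : (0 : ℝ) < k := by exact_mod_cast (by omega : 0 < k)
  have hnpos : (0 : ℝ) < n := by exact_mod_cast (by omega : 0 < n)
  have hz : z.re < 0 := by linarith
  have hz0 : z ≠ 0 := fun h => by simp [h] at hz
  have hzC' : ‖z‖ ≤ C' := hzC.trans (le_max_left _ _)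
  have hmem : z ∈ leftSector κ C' := by
    refine ⟨?_, hzC'⟩
    have : κ * ‖z‖ ≤ δ := by
      calc κ * ‖z‖ ≤ κ * C' := by gcongr
        _ = δ := div_mul_cancel₀ _ hC'0.ne'
    linarith
  have hw : (z / (n : ℂ)).re < 0 := by
    rw [Complex.div_natCast_re]
    exact div_neg_of_neg_of_pos hz hnpos
  have hζ : ∀ j : ℕ, ‖(ρ ^ j)⁻¹‖ = 1 := fun j => by
    rw [norm_inv, norm_pow, hρ.norm'_eq_one (by omega)]
    simp
  have hζ1 : ∀ j ∈ Finset.Ico 1 k, (ρ ^ j)⁻¹ ≠ 1 := fun j hj => by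
    have hj' := Finset.mem_Ico.1 hj
    rw [Ne, inv_eq_one]
    exact hρ.pow_ne_one_of_pos_of_lt (by omega) hj'.2
  have ht0 : ∀ j ∈ Finset.Ico 1 k, (0 : ℝ) < 1 - j / k := fun j hj => by
    have hj' : (j : ℝ) < k := by exact_mod_cast (Finset.mem_Ico.1 hj).2
    rw [sub_pos, div_lt_one hkpos]
    exact hj'
  have ht1 : ∀ j : ℕ, (1 : ℝ) - j / k ≤ 1 := fun j => by
    have : (0 : ℝ) ≤ (j : ℝ) / k := by positivity
    linarith
  set S : ℂ := n * Complex.log (-(z / n)) + Real.log (Nat.factorial n) +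
    ∑ i ∈ Finset.range n, logExpQuot (z / n * ((i : ℂ) + 1)) with hS
  set T : ℕ → ℂ := fun j => ∑ i ∈ Finset.range n, Complex.log (1 - (ρ ^ j)⁻¹ *
    Complex.exp (z / n * ((i : ℂ) + ((1 - j / k : ℝ) : ℂ)))) with hT
  set R₀ : ℂ := S - (-(n / z) * (polylog 2 (Complex.exp z) - polylog 2 1) +
    1 / 2 * (Real.log (2 * Real.pi) + logExpQuot z + Real.log n) +
    ∑ m ∈ Finset.Ico 1 L, (bernoulliNormalized (m + 1) 1 *
      ((z / n) ^ m * logOneSubDerivs 1 m z) - if m = 1 then z / n / 24 else 0)) with hR₀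
  set R : ℕ → ℂ := fun j => T j -
    (-(n / z) * (polylog 2 ((ρ ^ j)⁻¹ * Complex.exp z) - polylog 2 (ρ ^ j)⁻¹) +
      ∑ m ∈ Finset.range L, bernoulliNormalized (m + 1) (1 - j / k) *
        ((z / n) ^ m * (logOneSubDerivs (ρ ^ j)⁻¹ m z - logOneSubDerivs (ρ ^ j)⁻¹ m 0))) with hR
  have hprod : qProd (ρ * Complex.exp (z / ((k * n : ℕ) : ℂ))) (k * n) =
      Complex.exp (S + ∑ j ∈ Finset.Ico 1 k, T j) := by
    rw [qProd_eq_prod hk hn hρ, Finset.range_eq_Ico, Finset.prod_eq_prod_Ico_succ_bot hk,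
      Complex.exp_add, Complex.exp_sum, hS, ← prod_one_sub_exp_eq hw]
    refine congrArg₂ (· * ·) ?_ (Finset.prod_congr rfl fun j hj => ?_)
    · simp
    · exact prod_one_sub_mul_exp_eq (hζ j) hw (ht0 j hj) n
  -- The errors change sign because the product is inverted.
  refine ⟨-R₀ - ∑ j ∈ Finset.Ico 1 k, R j, ?_, ?_⟩
  · have hb : ∀ j ∈ Finset.Ico 1 k, ‖R j‖ ≤ c₁ / (n : ℝ) ^ L := by
      intro j hj
      refine (hcb _ (hζ j) (hζ1 j hj) z hmem hz0 n hn _ (ht0 j hj).le (ht1 j)).trans ?_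
      gcongr
      refine Finset.single_le_sum (f := c) (fun ζ _ => hc ζ)
        ((Polynomial.mem_nthRootsFinset (by omega) 1).2 ?_)
      rw [inv_pow, ← pow_mul, mul_comm, pow_mul, hρ.pow_eq_one, one_pow, inv_one]
    have hc₁0 : 0 ≤ c₁ := Finset.sum_nonneg fun ζ _ => hc ζ
    have h1 : ‖∑ j ∈ Finset.Ico 1 k, R j‖ ≤ k * (c₁ / (n : ℝ) ^ L) := by
      refine (norm_sum_le_of_le _ hb).trans ?_
      rw [Finset.sum_const, Nat.card_Ico, nsmul_eq_mul]
      gcongr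
      omega
    calc ‖-R₀ - ∑ j ∈ Finset.Ico 1 k, R j‖ ≤ c₀ / (n : ℝ) ^ L + k * (c₁ / (n : ℝ) ^ L) := by
          refine (norm_sub_le _ _).trans (add_le_add ?_ h1)
          rw [norm_neg]
          exact h₀ z hmem hz0 n hn
      _ = (c₀ + k * c₁) * k ^ L / ((k * n : ℕ) : ℝ) ^ L := by
          push_cast
          rw [mul_pow]
          field_simp
  · have hg : ((k : ℂ) / ((k * n : ℕ) : ℂ)) ^ (1 / 2 : ℂ) * gFun k ρ z =
        Complex.exp (-(1 / 2 * (Real.log (2 * Real.pi) + logExpQuot z + Real.log n)) +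
          ∑ j ∈ Finset.Ico 1 k, -(bernoulliNormalized 1 (1 - j / k) *
            (logOneSubDerivs (ρ ^ j)⁻¹ 0 z - logOneSubDerivs (ρ ^ j)⁻¹ 0 0))) := by
      have hkn : (k : ℂ) / ((k * n : ℕ) : ℂ) = 1 / n := by
        push_cast
        field_simp
      rw [gFun, Complex.exp_add, Complex.exp_sum, exp_neg_half_logs_eq_cpow_mul_cpow hz hn, hkn, ← mul_assoc]
      refine congrArg₂ (· * ·) rfl (Finset.prod_congr rfl fun j hj => ?_)
      rw [exp_neg_bernoulliNormalized_one_mul (hζ j) (hζ1 j hj) hz]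
      push_cast
      rfl
    have hf : ∑ ℓ ∈ Finset.Ico 1 L, fFun k ρ ℓ z / ((k * n : ℕ) : ℂ) ^ ℓ =
        -(∑ m ∈ Finset.Ico 1 L, (bernoulliNormalized (m + 1) 1 *
          ((z / n) ^ m * logOneSubDerivs 1 m z) - if m = 1 then z / n / 24 else 0)) -
        ∑ j ∈ Finset.Ico 1 k, ∑ m ∈ Finset.Ico 1 L, bernoulliNormalized (m + 1) (1 - j / k) *
          ((z / n) ^ m * (logOneSubDerivs (ρ ^ j)⁻¹ m z - logOneSubDerivs (ρ ^ j)⁻¹ m 0)) := by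
      rw [Finset.sum_congr rfl fun m hm => fFun_div_pow_eq hk hn ρ z (Finset.mem_Ico.1 hm).1,
        Finset.sum_sub_distrib, Finset.sum_neg_distrib, Finset.sum_comm]
    have hRsum : ∑ j ∈ Finset.Ico 1 k, R j = ∑ j ∈ Finset.Ico 1 k, T j +
        n / z * ∑ j ∈ Finset.Ico 1 k,
          (polylog 2 ((ρ ^ j)⁻¹ * Complex.exp z) - polylog 2 (ρ ^ j)⁻¹) +
        ∑ j ∈ Finset.Ico 1 k, -(bernoulliNormalized 1 (1 - j / k) *
            (logOneSubDerivs (ρ ^ j)⁻¹ 0 z - logOneSubDerivs (ρ ^ j)⁻¹ 0 0)) -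
        ∑ j ∈ Finset.Ico 1 k, ∑ m ∈ Finset.Ico 1 L, bernoulliNormalized (m + 1) (1 - j / k) *
          ((z / n) ^ m * (logOneSubDerivs (ρ ^ j)⁻¹ m z - logOneSubDerivs (ρ ^ j)⁻¹ m 0)) := by
      rw [Finset.mul_sum, ← Finset.sum_add_distrib, ← Finset.sum_add_distrib,
        ← Finset.sum_sub_distrib]
      refine Finset.sum_congr rfl fun j _ => ?_
      simp only [hR]
      rw [sum_range_eq_add_Ico_one _ hL, zero_add, pow_zero]
      ring
    rw [hprod, hg, hf, ← mul_sum_polylog_two_sub_eq hk hρ hz, one_div, ← Complex.exp_neg,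
      ← Complex.exp_add, hRsum, hR₀]
    congr 1
    ring
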